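/- Let $\beta\in\mathbb{R}\setminus\{0\}$ and $M\in\mathbb{R}$. Consider on $\mathbb{R}^3$ the Rikitake vector field $$X^\beta(x,y,z)=(yz+\beta y)\,\partial_x+(xz-\beta x)\,\partial_y-xy\,\partial_z ,$$ the functions $C_\beta(x,y,z)=\tfrac14(-x^2+y^2)-\beta z$ and $H(x,y,z)=\tfrac12(x^2+y^2)+z^2$, and the Poisson bracket defined by $\{f,g\}\,dx\wedge dy\wedge dz=-\,dC_\beta\wedge df\wedge dg$. Let $\Sigma=\Sigma^\beta_{-\beta M}=\{(x,y,z)\in\mathbb{R}^3: C_\beta(x,y,z)=-\beta M\}$. Then $X^\beta$ is the Hamiltonian vector field of $H$ for this bracket (its components are $\{x_i,H\}$), the point $(0,0,M)$ is an equilibrium of $X^\beta$ lying on $\Sigma$, and $\Sigma$ is the symplectic leaf through $(0,0,M)$ (the set of points that can be joined with $(0,0,M)$ by finitely many pieces of integral curves of Hamiltonian vector fields); it is regular, that is, the Poisson structure has rank $2$ at every point of $\Sigma$. The restricted vector field $X^\beta|_\Sigma$ has a globally defined flow $F_t:\Sigma\to\Sigma$, $t\in\mathbb{R}$, and the following hold.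 (a) The linearization $v\mapsto \frac{d}{dt}\big|_{t=0} DF_t(0,0,M)\,v$ of $X^\beta|_\Sigma$ at $(0,0,M)$, a linear map of $T_{(0,0,M)}\Sigma=\ker dC_\beta(0,0,M)$ into itself, exists and has characteristic polynomial $\mu^2+(\beta^2-M^2)$. (b) If $|\beta|<|M|$, then $(0,0,M)$ is an unstable (that is, not Lyapunov stable) equilibrium of $X^\beta|_\Sigma$. (c) If $|\beta|>|M|$, then $(0,0,M)$ is a Lyapunov stable equilibrium of $X^\beta|_\Sigma$: for every relatively open neighborhood $U$ of it in $\Sigma$ there is a relatively open neighborhood $V\subseteq U$ of it with $F_t(V)\subseteq U$ for all $t\ge 0$. (d) If $|\beta|>|M|$, then there are $\varepsilon_0>0$ and a one-parameter family $\{\gamma_\varepsilon\}_{0<\varepsilon\le\varepsilon_0}$ of pairwise disjoint periodic orbits of $X^\beta|_\Sigma$ in $\Sigma$, with initial points $x_\varepsilon\in\gamma_\varepsilon$ and minimal periods $T_\varepsilon>0$ depending continuously on $\varepsilon\in(0,\varepsilon_0]$, which shrink to $(0,0,M)$ as $\varepsilon\to0$ (every neighborhood of $(0,0,M)$ contains $\gamma_\varepsilon$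 for all small $\varepsilon$), and with $T_\varepsilon\to 2\pi/\sqrt{\beta^2-M^2}$ as $\varepsilon\to 0$. Moreover, $\{(0,0,M)\}\cup\bigcup_{0<\varepsilon<\varepsilon_0}\gamma_\varepsilon$ is the connected component of $\Sigma\setminus\gamma_{\varepsilon_0}$ that contains $(0,0,M)$. For $M=0$ this gives periodic orbits around the origin. -/

import Mathlib

open Set Filter Topology
open scoped ContDiff

namespace Rikitake

noncomputable section

/-- The phase space `ℝ³`, with coordinates `(x, y, z) = (p 0, p 1, p 2)`. -/
abbrev E3 : Type := EuclideanSpace ℝ (Fin 3)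

/-- The Rikitake vector field `X_β = (yz + βy) ∂/∂x + (xz - βx) ∂/∂y - xy ∂/∂z`. -/
def vectorField (β : ℝ) (p : E3) : E3 :=
  !₂[p 1 * p 2 + β * p 1, p 0 * p 2 - β * p 0, -(p 0 * p 1)]

/-- The first integral `C_β(x, y, z) = (-x² + y²)/4 - βz`. -/
def casimir (β : ℝ) (p : E3) : ℝ :=
  (1 / 4) * (-(p 0) ^ 2 + (p 1) ^ 2) - β * p 2

/-- The first integral `H(x, y, z) = (x² + y²)/2 + z²`. -/
def hamiltonian (p : E3) : ℝ :=
  (1 / 2) * ((p 0) ^ 2 + (p 1) ^ 2) + (p 2) ^ 2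

/-- The equilibrium point `(0, 0, M)`. -/
def eqPoint (M : ℝ) : E3 := !₂[0, 0, M]

/-- The hyperbolic paraboloid `Σ^β_c = {C_β = c}`. -/
def leaf (β c : ℝ) : Set E3 := {p | casimir β p = c}

section Poisson

/-- The row of partial derivatives of `f` at `p`. -/
def partials (f : E3 → ℝ) (p : E3) : Fin 3 → ℝ :=
  fun i => fderiv ℝ f p (EuclideanSpace.single i 1)

/-- The bracket `{f, g}_{ν; C}`, defined by `{f, g} dx ∧ dy ∧ dz = ν dC ∧ df ∧ dg`. -/
def poissonBracket (ν C f g : E3 → ℝ) (p : E3) : ℝ :=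
  ν p * (Matrix.of ![partials C p, partials f p, partials g p]).det

/-- The matrix `({x_k, x_l}_{ν; C}(p))` of the Poisson structure. -/
def poissonMatrix (ν C : E3 → ℝ) (p : E3) : Matrix (Fin 3) (Fin 3) ℝ :=
  Matrix.of fun k l => poissonBracket ν C (fun q => q k) (fun q => q l) p

/-- The Hamiltonian vector field of `f`, with components `{x_i, f}_{ν; C}`. -/
def hamiltonianVectorField (ν C f : E3 → ℝ) (p : E3) : E3 :=
  WithLp.toLp 2 fun i => poissonBracket ν C (fun q => q i) f p

/-- `a` and `b` are the end points of a piece of an integral curve of the Hamiltonian vector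
field of some smooth function. -/
def HamiltonianStep (ν C : E3 → ℝ) (a b : E3) : Prop :=
  ∃ f : E3 → ℝ, ContDiff ℝ ∞ f ∧ ∃ (γ : ℝ → E3) (T : ℝ), 0 ≤ T ∧
    IsIntegralCurveOn γ (fun _ => hamiltonianVectorField ν C f) (Icc 0 T) ∧ γ 0 = a ∧ γ T = b

/-- The symplectic leaf through `p`: all points that can be joined with `p` by a finite
concatenation of pieces of integral curves of Hamiltonian vector fields. -/
def symplecticLeaf (ν C : E3 → ℝ) (p : E3) : Set E3 :=
  {q | Relation.ReflTransGen (HamiltonianStep ν C) p q}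

end Poisson

section Dynamics

/-- `F` is the (complete) flow of the restriction `X|_S` of the vector field `X` to `S`:
`F t` maps `S` to `S`, and for `x ∈ S` the curve `t ↦ F t x` is the integral curve of `X` that
starts at `x`. The values of `F t` outside `S` are irrelevant. -/
structure IsFlowOn (X : E3 → E3) (S : Set E3) (F : ℝ → E3 → E3) : Prop where
  mapsTo : ∀ t, MapsTo (F t) S S
  map_zero : ∀ x ∈ S, F 0 x = x
  hasDerivAt : ∀ x ∈ S, ∀ t, HasDerivAt (fun s => F s x) (X (F t x)) t

/-- Lyapunov stability, with respect to the topology of `S`, of the equilibrium `p` for the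
flow `F` on `S`. The relatively open subsets of `S` are the sets `U ∩ S` with `U` open. -/
def LyapunovStableOn (F : ℝ → E3 → E3) (S : Set E3) (p : E3) : Prop :=
  ∀ U : Set E3, IsOpen U → p ∈ U → ∃ V : Set E3, IsOpen V ∧ p ∈ V ∧ V ∩ S ⊆ U ∩ S ∧
    ∀ x ∈ V ∩ S, ∀ t : ℝ, 0 ≤ t → F t x ∈ U ∩ S

/-- The tangent space at `p` of the level set of `C` through `p`, where `dC p ≠ 0`. -/
abbrev tangentSpace (C : E3 → ℝ) (p : E3) : Submodule ℝ E3 :=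
  LinearMap.ker (fderiv ℝ C p : E3 →ₗ[ℝ] ℝ)

/-- `L` is the linearization at the equilibrium `p` of the vector field on the surface
`S = {C = C p}` whose flow is `F`, that is
`L v = d/dt (D(F_t|_S)(p) v)` at `t = 0`, for all tangent vectors `v` of `S` at `p`.
The differential of `F_t|_S` at `p` is the restriction to the tangent space of
a derivative of `F_t` within `S`. -/
def IsLinearizationOn (F : ℝ → E3 → E3) (S : Set E3) (C : E3 → ℝ) (p : E3)
    (L : tangentSpace C p →ₗ[ℝ] tangentSpace C p) : Prop :=
  ∃ D : ℝ → E3 →L[ℝ] E3, (∀ t, HasFDerivWithinAt (F t) (D t) S p) ∧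
    ∀ v : tangentSpace C p, HasDerivAt (fun t => D t (v : E3)) (L v : E3) 0

/-- The orbit of `x`. -/
def orbit (F : ℝ → E3 → E3) (x : E3) : Set E3 := range fun t => F t x

/-- The orbit of `x` is periodic, with minimal period `T`. -/
def HasMinimalPeriod (F : ℝ → E3 → E3) (x : E3) (T : ℝ) : Prop :=
  0 < T ∧ (∀ t, F (t + T) x = F t x) ∧ ∀ s, 0 < s → s < T → F s x ≠ x

end Dynamics

end

end Rikitake

/-! The field preserves both `hamiltonian` and `casimir β`. Sublevel sets of `hamiltonian` are
bounded, so trajectories are complete, and the Casimir keeps them on the leaf. The leaf is a graph z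
= M + (y² - x²)/(4β) over the (x, y)-plane. A linear Hamiltonian joins (0, 0, M) to any of its
points in a single step, so the level set is exactly the symplectic leaf.

(a) Grönwall's inequality shows that the flow has derivative exp(tA) at the equilibrium within the
leaf, where A is the linear part of the field; on the tangent plane A has trace 0 and determinant β²
- M² (`IsFlowOn.isLinearizationOn_iff`).

(b) Near (0, 0, M) the function xy, with the sign of M, grows exponentially wherever it is positive,
which is Chetaev's criterion.

(c) On the leaf, H = M² + a x² + b y² + (z - M)² with a = (β - M)/(2β) and b = (β + M)/(2β)
(`hamiltonian_graphPoint`). If |M| < |β|, both coefficients are positive and H is a Lyapunov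
function.

(d) The orbits are the levels H = M² + ε². With x = A r cos φ, y = B r sin φ, A = a^(-1/2), B =
b^(-1/2), a level reads r² + q(φ)² r⁴ = ε², which is solved explicitly for r. The flow on it reduces
to the scalar equation φ' = -2kg(φ), with k = β/(AB) and g = √(1 + 4ε²q²) (`hasDerivAt_orbitPoint`).
Hence the period is the integral of 1/(2|k|g) over a turn. It is continuous in ε and tends to π/|k|
= 2π/√(β² - M²), because g tends to 1. -/

namespace Rikitake

/-! ### Complete integral curves, and flows near an equilibrium -/

section ODE

variable {E : Type*} [NormedAddCommGroup E] [NormedSpace ℝ E]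

/-- A bounded Lipschitz vector field on a Banach space is complete. -/
theorem exists_integralCurve_of_lipschitzWith [CompleteSpace E] {v : E → E} {K L : NNReal}
    (hv : LipschitzWith K v) (hL : ∀ x, ‖v x‖ ≤ L) (x : E) :
    ∃ γ : ℝ → E, γ 0 = x ∧ ∀ t, HasDerivAt γ (v (γ t)) t := by
  -- A speed bound `L` confines the curve to the ball of radius `L * n` up to time `n`, so
  -- Picard–Lindelöf applies on the whole interval.
  have key : ∀ n : NNReal, ∃ γ : ℝ → E, γ 0 = x ∧
      ∀ t ∈ Icc (-n : ℝ) n, HasDerivWithinAt γ (v (γ t)) (Icc (-n : ℝ) n) t := by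
    intro n
    have h0 : (0 : ℝ) ∈ Icc (-n : ℝ) n := by simp
    have hp : IsPicardLindelof (fun _ => v) (tmin := -n) (tmax := n) ⟨0, h0⟩ x (L * n) 0 L K :=
      IsPicardLindelof.of_time_independent (fun y _ => hL y) hv.lipschitzOnWith (by simp)
    exact hp.exists_eq_forall_mem_Icc_hasDerivWithinAt₀
  choose γ h0 hγ using key
  have hγ' : ∀ n : NNReal, ∀ t ∈ Ioo (-n : ℝ) n, HasDerivAt (γ n) (v (γ n t)) t := fun n t ht =>
    (hγ n t (Ioo_subset_Icc_self ht)).hasDerivAt (Icc_mem_nhds ht.1 ht.2)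
  have agree : ∀ m n : NNReal, m ≤ n → EqOn (γ m) (γ n) (Ioo (-m : ℝ) m) := by
    intro m n hmn t ht
    have hmn' : (m : ℝ) ≤ n := hmn
    refine ODE_solution_unique_of_mem_Ioo (v := fun _ => v) (s := fun _ => univ) (t₀ := 0)
      (fun t _ => hv.lipschitzOnWith) ?_ (fun s hs => ⟨hγ' m s hs, trivial⟩)
      (fun s hs => ⟨hγ' n s ⟨by linarith [hs.1], by linarith [hs.2]⟩, trivial⟩)
      ((h0 m).trans (h0 n).symm) ht
    constructor <;> linarith [ht.1, ht.2]
  -- The extra 1 makes `t` interior. The curve with index `‖t‖₊ + 2` agrees with the glued one on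
  -- the unit ball around `t`, so it supplies the derivative there.
  refine ⟨fun t => γ (‖t‖₊ + 1) t, h0 _, fun t => ?_⟩
  have hmem : ∀ s : ℝ, s ∈ Ioo (-((‖s‖₊ + 1 : NNReal) : ℝ)) ((‖s‖₊ + 1 : NNReal) : ℝ) := by
    intro s
    have := abs_le.1 (le_refl |s|)
    simp only [NNReal.coe_add, coe_nnnorm, Real.norm_eq_abs, NNReal.coe_one, mem_Ioo]
    constructor <;> linarith [this.1, this.2]
  have hmem2 : t ∈ Ioo (-((‖t‖₊ + 2 : NNReal) : ℝ)) ((‖t‖₊ + 2 : NNReal) : ℝ) := by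
    have := hmem t
    simp only [NNReal.coe_add, NNReal.coe_one, NNReal.coe_ofNat, mem_Ioo] at this ⊢
    constructor <;> linarith [this.1, this.2]
  have hd := hγ' _ t hmem2
  have he : γ (‖t‖₊ + 1) t = γ (‖t‖₊ + 2) t :=
    agree _ _ (by gcongr; norm_num) (hmem t)
  simp only [he]
  refine hd.congr_of_eventuallyEq ?_
  filter_upwards [Metric.ball_mem_nhds t one_pos] with s hs
  refine agree _ _ ?_ (hmem s)
  rw [Metric.mem_ball, Real.dist_eq] at hs
  rw [← NNReal.coe_le_coe]
  simp only [NNReal.coe_add, NNReal.coe_one, NNReal.coe_ofNat, coe_nnnorm, Real.norm_eq_abs]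
  have := abs_sub_abs_le_abs_sub s t
  linarith

theorem ContDiff.exists_lipschitzOnWith_closedBall [FiniteDimensional ℝ E] {X : E → E}
    (hX : ContDiff ℝ 1 X) (c : E) (R : ℝ) :
    ∃ K, LipschitzOnWith K X (Metric.closedBall c R) :=
  LocallyLipschitzOn.exists_lipschitzOnWith_of_compact (isCompact_closedBall c R)
    hX.locallyLipschitz.locallyLipschitzOn

theorem integralCurve_unique_of_isBounded [FiniteDimensional ℝ E] {X : E → E}
    (hX : ContDiff ℝ 1 X) {γ η : ℝ → E} (hγ : ∀ t, HasDerivAt γ (X (γ t)) t)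
    (hη : ∀ t, HasDerivAt η (X (η t)) t) {B : Set E} (hB : Bornology.IsBounded B)
    (hγB : ∀ t, γ t ∈ B) (hηB : ∀ t, η t ∈ B) {t₀ : ℝ} (h : γ t₀ = η t₀) : γ = η := by
  obtain ⟨R, hR⟩ := hB.subset_closedBall 0
  obtain ⟨K, hK⟩ := ContDiff.exists_lipschitzOnWith_closedBall hX 0 R
  exact ODE_solution_unique_univ (v := fun _ => X) (s := fun _ => Metric.closedBall 0 R)
    (fun _ => hK) (fun t => ⟨hγ t, hR (hγB t)⟩) (fun t => ⟨hη t, hR (hηB t)⟩) h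

theorem firstIntegral_const {X : E → E} {H : E → ℝ} (hH : Differentiable ℝ H)
    (hHX : ∀ p, fderiv ℝ H p (X p) = 0) {γ : ℝ → E} (hγ : ∀ t, HasDerivAt γ (X (γ t)) t)
    (t s : ℝ) : H (γ t) = H (γ s) := by
  have hd : ∀ t, HasDerivAt (fun t => H (γ t)) 0 t := fun t => by
    have := (hH (γ t)).hasFDerivAt.comp_hasDerivAt t (hγ t)
    rwa [hHX] at this
  exact is_const_of_deriv_eq_zero (fun t => (hd t).differentiableAt) (fun t => (hd t).deriv) t s

/-- A `C¹` vector field with a proper first integral is complete. -/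
theorem exists_integralCurve_of_firstIntegral [FiniteDimensional ℝ E] {X : E → E}
    (hX : ContDiff ℝ 1 X) {H : E → ℝ} (hH : Differentiable ℝ H)
    (hHX : ∀ p, fderiv ℝ H p (X p) = 0)
    (hb : ∀ c, Bornology.IsBounded {p | H p ≤ c}) (x : E) :
    ∃ γ : ℝ → E, γ 0 = x ∧ ∀ t, HasDerivAt γ (X (γ t)) t := by
  obtain ⟨R, hR⟩ := (hb (H x)).subset_closedBall 0
  -- The cut-off field is bounded and Lipschitz and still has `H` as first integral. Its curve
  -- therefore stays in the sublevel set of `x`, where the cut-off equals 1. `max R 1` only keeps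
  -- the inner radius positive.
  let χ : ContDiffBump (0 : E) := ⟨max R 1, max R 1 + 1, by positivity, by linarith⟩
  let Y : E → E := fun p => χ p • X p
  have hYc : HasCompactSupport Y := χ.hasCompactSupport.smul_right
  have hYd : ContDiff ℝ 1 Y := (χ.contDiff (n := 1)).smul hX
  obtain ⟨K, hK⟩ := hYd.lipschitzWith_of_hasCompactSupport hYc one_ne_zero
  obtain ⟨C, hC⟩ := hYc.exists_bound_of_continuous hYd.continuous
  obtain ⟨γ, h0, hγ⟩ := exists_integralCurve_of_lipschitzWith (L := C.toNNReal) hK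
    (fun p => (hC p).trans (Real.le_coe_toNNReal C)) x
  refine ⟨γ, h0, fun t => ?_⟩
  have hc : H (γ t) = H x := by
    rw [← h0]
    exact firstIntegral_const hH (X := Y) (fun p => by simp [Y, hHX]) hγ t 0
  have h1 : χ (γ t) = 1 := χ.one_of_mem_closedBall
    (Metric.closedBall_subset_closedBall (le_max_left R 1) (hR hc.le))
  have := hγ t
  simpa only [Y, h1, one_smul] using this

/-- Linearity in the defect is what turns a quadratic error of the vector field into a quadratic
error of the flow. -/
theorem gronwallBound_zero_left (K ε x : ℝ) :
    gronwallBound 0 K ε x = gronwallBound 0 K 1 x * ε := by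
  unfold gronwallBound
  split_ifs <;> ring

/-- Forward-time differentiability of a flow at an equilibrium. -/
theorem hasFDerivWithinAt_flow_of_nonneg [CompleteSpace E] {X : E → E} {A : E →L[ℝ] E} {p : E}
    {C : ℝ} (hXA : ∀ y, ‖X (p + y) - A y‖ ≤ C * ‖y‖ ^ 2) {S B : Set E} {K : NNReal}
    (hK : LipschitzOnWith K X B) {F : ℝ → E → E} (hpS : p ∈ S) (hpB : p ∈ B)
    (hF0 : ∀ x ∈ S, F 0 x = x) (hF : ∀ x ∈ S, ∀ t, HasDerivAt (fun s => F s x) (X (F t x)) t)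
    (hB : ∀ᶠ x in 𝓝[S] p, ∀ t, F t x ∈ B) {t : ℝ} (ht : 0 ≤ t) :
    HasFDerivWithinAt (F t) (NormedSpace.exp (t • A)) S p := by
  have hXp : X p = 0 := by simpa using hXA 0
  -- No sign of `C` is assumed, but a negative `C` is possible only on the trivial space.
  have hC : 0 ≤ C ∨ ∀ y : E, y = 0 := by
    by_contra! h
    obtain ⟨hC, y, hy⟩ := h
    have h1 := (norm_nonneg _).trans (hXA y)
    have : 0 < ‖y‖ ^ 2 := by positivity
    nlinarith
  rcases hC with hC | hE
  swap
  · have := (subsingleton_of_forall_eq (0 : E) hE)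
    exact (hasFDerivAt_of_subsingleton (F t) p).hasFDerivWithinAt.congr_fderiv
      (Subsingleton.elim _ _)
  -- Grönwall against the constant solution `p`.
  have hgrow : ∀ x ∈ S, (∀ s, F s x ∈ B) → ∀ s ∈ Icc 0 t,
      ‖F s x - p‖ ≤ ‖x - p‖ * Real.exp (K * t) := by
    intro x hx hxB s hs
    have := dist_le_of_trajectories_ODE_of_mem (v := fun _ => X) (s := fun _ => B) (K := K)
      (f := fun s => F s x) (g := fun _ => p) (a := 0) (b := t) (δ := ‖x - p‖) (fun _ _ => hK)
      (fun s _ => (hF x hx s).continuousAt.continuousWithinAt)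
      (fun s _ => (hF x hx s).hasDerivWithinAt) (fun s _ => hxB s) continuousOn_const
      (fun s _ => by rw [hXp]; exact hasDerivWithinAt_const ..) (fun _ _ => hpB)
      (by rw [hF0 x hx, dist_eq_norm]) s hs
    rw [dist_eq_norm, sub_zero] at this
    refine this.trans ?_
    gcongr
    exact hs.2
  have hFp : F t p = p := by
    have hpB' : ∀ s, F s p ∈ B := hB.self_of_nhdsWithin hpS
    have := hgrow p hpS hpB' t ⟨ht, le_rfl⟩
    simpa [sub_eq_zero] using this
  set c := gronwallBound 0 (‖A‖₊ : ℝ) 1 t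
  -- The curve `F s x - p` solves the linear equation up to a defect of order `‖x - p‖ ^ 2`; it is
  -- compared with the exact linear solution having the same initial value.
  have main : ∀ x ∈ S, (∀ s, F s x ∈ B) →
      ‖F t x - p - NormedSpace.exp (t • A) (x - p)‖ ≤
        c * (C * Real.exp (K * t) ^ 2) * ‖x - p‖ ^ 2 := by
    intro x hx hxB
    have := dist_le_of_approx_trajectories_ODE_of_mem (v := fun _ => A) (s := fun _ => univ)
      (K := ‖A‖₊) (f := fun s => F s x - p) (g := fun s => NormedSpace.exp (s • A) (x - p))
      (f' := fun s => X (F s x)) (g' := fun s => A (NormedSpace.exp (s • A) (x - p)))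
      (a := 0) (b := t) (δ := 0) (εf := C * (‖x - p‖ * Real.exp (K * t)) ^ 2) (εg := 0)
      (fun _ _ => A.lipschitz.lipschitzOnWith)
      (fun s _ => ((hF x hx s).sub_const p).continuousAt.continuousWithinAt)
      (fun s _ => ((hF x hx s).sub_const p).hasDerivWithinAt)
      (fun s hs => by
        rw [dist_eq_norm]
        have h1 := hXA (F s x - p)
        rw [add_sub_cancel] at h1
        refine h1.trans ?_
        gcongr
        exact hgrow x hx hxB s ⟨hs.1, hs.2.le⟩)
      (fun _ _ => trivial)
      (fun s _ => ((hasDerivAt_exp_smul_const' (𝕂 := ℝ) A s).clm_apply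
        (hasDerivAt_const s (x - p))).continuousAt.continuousWithinAt)
      (fun s _ => by
        simpa using ((hasDerivAt_exp_smul_const' (𝕂 := ℝ) A s).clm_apply
          (hasDerivAt_const s (x - p))).hasDerivWithinAt)
      (fun s _ => by simp) (fun _ _ => trivial) (by simp [hF0 x hx]) t ⟨ht, le_rfl⟩
    rw [dist_eq_norm, gronwallBound_zero_left, sub_zero] at this
    refine this.trans (le_of_eq ?_)
    ring
  have hO : (fun x => F t x - p - NormedSpace.exp (t • A) (x - p)) =O[𝓝[S] p]
      fun x => ‖x - p‖ ^ 2 := by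
    refine Asymptotics.IsBigO.of_bound (c * (C * Real.exp (K * t) ^ 2)) ?_
    filter_upwards [hB, self_mem_nhdsWithin] with x hxB hx
    simpa using main x hx hxB
  have h1 := hO.hasFDerivWithinAt (𝕜 := ℝ) hpS (by norm_num)
  have h2 : HasFDerivWithinAt (fun x => NormedSpace.exp (t • A) (x - p))
      (NormedSpace.exp (t • A)) S p := by
    have h := (NormedSpace.exp (t • A) : E →L[ℝ] E).hasFDerivWithinAt (s := S) (x := p)
    simpa using h.sub_const (NormedSpace.exp (t • A) p)
  have h3 := (h1.add h2).add_const p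
  rw [zero_add] at h3
  refine h3.congr (fun x _ => ?_) (by simp)
  simp

/-- Differentiability of a flow at an equilibrium, with the exponential of the linear part of the
vector field as derivative. -/
theorem hasFDerivWithinAt_flow [CompleteSpace E] {X : E → E} {A : E →L[ℝ] E} {p : E}
    {C : ℝ} (hXA : ∀ y, ‖X (p + y) - A y‖ ≤ C * ‖y‖ ^ 2) {S B : Set E} {K : NNReal}
    (hK : LipschitzOnWith K X B) {F : ℝ → E → E} (hpS : p ∈ S) (hpB : p ∈ B)
    (hF0 : ∀ x ∈ S, F 0 x = x) (hF : ∀ x ∈ S, ∀ t, HasDerivAt (fun s => F s x) (X (F t x)) t)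
    (hB : ∀ᶠ x in 𝓝[S] p, ∀ t, F t x ∈ B) (t : ℝ) :
    HasFDerivWithinAt (F t) (NormedSpace.exp (t • A)) S p := by
  rcases le_total 0 t with ht | ht
  · exact hasFDerivWithinAt_flow_of_nonneg hXA hK hpS hpB hF0 hF hB ht
  -- Negative times are positive times of the reversed flow, which belongs to `-X` with linear part
  -- `-A`.
  · have := hasFDerivWithinAt_flow_of_nonneg (X := fun x => -X x) (A := -A) (p := p) (C := C)
      (S := S) (B := B) (K := K) (F := fun t => F (-t)) (t := -t)
      (fun y => by
        have h := hXA y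
        rw [← norm_neg] at h
        have e : -X (p + y) - (-A) y = -(X (p + y) - A y) := by
          rw [neg_apply]
          abel
        rwa [e])
      hK.neg hpS hpB (by simpa using hF0)
      (fun x hx s => by
        simpa [Function.comp_def] using (hF x hx (-s)).scomp s (hasDerivAt_neg s))
      (hB.mono fun x hx s => hx (-s)) (by linarith)
    simpa using this

theorem hasDerivAt_exp_smul_apply_zero [CompleteSpace E] (A : E →L[ℝ] E) (v : E) :
    HasDerivAt (fun t : ℝ => NormedSpace.exp (t • A) v) (A v) 0 := by
  have := (hasDerivAt_exp_smul_const (𝕂 := ℝ) A 0).clm_apply (hasDerivAt_const (0 : ℝ) v)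
  simpa using this

end ODE

/-! ### The Poisson structure, its rank and its symplectic leaf -/

theorem hasFDerivAt_coord (i : Fin 3) (p : E3) :
    HasFDerivAt (fun q : E3 => q i) (EuclideanSpace.proj i : E3 →L[ℝ] ℝ) p :=
  (EuclideanSpace.proj i : E3 →L[ℝ] ℝ).hasFDerivAt

theorem hasDerivAt_E3_iff {γ : ℝ → E3} {v : E3} {t : ℝ} :
    HasDerivAt γ v t ↔ ∀ i, HasDerivAt (fun s => γ s i) (v i) t := by
  constructor
  · intro h i
    exact (hasFDerivAt_coord i (γ t)).comp_hasDerivAt t h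
  · intro h
    have h1 : HasDerivAt (fun s => (γ s).ofLp) v.ofLp t := hasDerivAt_pi.2 h
    exact ((EuclideanSpace.equiv (Fin 3) ℝ).symm.hasFDerivAt.comp_hasDerivAt t h1)

theorem hasFDerivAt_casimir (β : ℝ) (p : E3) :
    HasFDerivAt (casimir β) ((-(p 0) / 2) • (EuclideanSpace.proj 0 : E3 →L[ℝ] ℝ) +
      (p 1 / 2) • (EuclideanSpace.proj 1 : E3 →L[ℝ] ℝ) +
      (-β) • (EuclideanSpace.proj 2 : E3 →L[ℝ] ℝ)) p := by
  have h := ((((hasFDerivAt_coord 0 p).pow 2).neg.add ((hasFDerivAt_coord 1 p).pow 2)).const_mul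
    (1 / 4)).sub ((hasFDerivAt_coord 2 p).const_mul β)
  refine h.congr_fderiv ?_
  ext v
  simp
  ring

theorem hasFDerivAt_hamiltonian (p : E3) :
    HasFDerivAt hamiltonian ((p 0) • (EuclideanSpace.proj 0 : E3 →L[ℝ] ℝ) +
      (p 1) • (EuclideanSpace.proj 1 : E3 →L[ℝ] ℝ) +
      (2 * p 2) • (EuclideanSpace.proj 2 : E3 →L[ℝ] ℝ)) p := by
  have h := ((((hasFDerivAt_coord 0 p).pow 2).add ((hasFDerivAt_coord 1 p).pow 2)).const_mul
    (1 / 2)).add ((hasFDerivAt_coord 2 p).pow 2)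
  refine h.congr_fderiv ?_
  ext v
  simp
  ring

theorem partials_casimir (β : ℝ) (p : E3) : partials (casimir β) p = ![-(p 0) / 2, p 1 / 2, -β] := by
  ext i
  rw [partials, (hasFDerivAt_casimir β p).fderiv]
  fin_cases i <;> simp

theorem partials_hamiltonian (p : E3) : partials hamiltonian p = ![p 0, p 1, 2 * p 2] := by
  ext i
  rw [partials, (hasFDerivAt_hamiltonian p).fderiv]
  fin_cases i <;> simp

theorem partials_coord (j : Fin 3) (p : E3) : partials (fun q => q j) p = Pi.single j 1 := by
  ext i
  rw [partials, (hasFDerivAt_coord j p).fderiv]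
  simp [Pi.single_apply, eq_comm]

theorem casimir_bracket_coord (β : ℝ) (f : E3 → ℝ) (i : Fin 3) (p : E3) :
    poissonBracket (fun _ => -1) (casimir β) (fun q => q i) f p =
      ![β * partials f p 1 + p 1 / 2 * partials f p 2,
        -β * partials f p 0 + p 0 / 2 * partials f p 2,
        -(p 1) / 2 * partials f p 0 - p 0 / 2 * partials f p 1] i := by
  rw [poissonBracket, partials_casimir, partials_coord, Matrix.det_fin_three]
  fin_cases i <;> simp <;> ring

theorem vectorField_eq_hamiltonianVectorField (β : ℝ) :
    vectorField β = hamiltonianVectorField (fun _ => -1) (casimir β) hamiltonian := by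
  ext p i
  simp only [hamiltonianVectorField, casimir_bracket_coord, partials_hamiltonian]
  fin_cases i <;> simp [vectorField] <;> ring

theorem poissonMatrix_casimir (β : ℝ) (p : E3) :
    poissonMatrix (fun _ => -1) (casimir β) p =
      !![0, β, p 1 / 2; -β, 0, p 0 / 2; -(p 1) / 2, -(p 0) / 2, 0] := by
  ext k l
  simp only [poissonMatrix, Matrix.of_apply, casimir_bracket_coord, partials_coord]
  fin_cases k <;> fin_cases l <;> (simp; try ring)

/-- A skew-symmetric matrix of odd size is singular, while the upper left minor is β² ≠ 0. -/
theorem rank_poissonMatrix {β : ℝ} (hβ : β ≠ 0) (p : E3) :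
    (poissonMatrix (fun _ => -1) (casimir β) p).rank = 2 := by
  set N := poissonMatrix (fun _ => -1) (casimir β) p with hN
  rw [poissonMatrix_casimir] at hN
  apply le_antisymm
  · have hdet : N.det = 0 := by
      rw [hN, Matrix.det_fin_three]
      simp
      ring
    have h3 : N.rank ≤ 3 := by simpa using N.rank_le_width
    have hne : N.rank ≠ 3 := by
      intro h
      have hu : IsUnit N := by
        rw [← Matrix.linearIndependent_rows_iff_isUnit, linearIndependent_iff_card_eq_finrank_span,
          Set.finrank, ← Matrix.rank_eq_finrank_span_row, h, Fintype.card_fin]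
      rw [Matrix.isUnit_iff_isUnit_det, hdet] at hu
      exact not_isUnit_zero hu
    omega
  · have hsub : (N.submatrix ![0, 1] ![0, 1]).rank = 2 := by
      have hu : IsUnit (N.submatrix ![0, 1] ![0, 1]) := by
        rw [Matrix.isUnit_iff_isUnit_det, Matrix.det_fin_two, hN]
        simp [hβ]
      simpa using Matrix.rank_of_isUnit _ hu
    rw [← hsub]
    exact Matrix.rank_submatrix_le _ _ _

theorem mem_leaf_iff {β : ℝ} (hβ : β ≠ 0) {M : ℝ} {p : E3} :
    p ∈ leaf β (-β * M) ↔ p 2 = M + (p 1 ^ 2 - p 0 ^ 2) / (4 * β) := by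
  rw [leaf, mem_ofPred_eq, casimir]
  field_simp
  constructor <;> intro h <;> linarith

theorem fderiv_casimir_hamiltonianVectorField (β : ℝ) (f : E3 → ℝ) (p : E3) :
    fderiv ℝ (casimir β) p (hamiltonianVectorField (fun _ => -1) (casimir β) f p) = 0 := by
  rw [(hasFDerivAt_casimir β p).fderiv]
  simp [hamiltonianVectorField, casimir_bracket_coord]
  ring

theorem fderiv_casimir_vectorField (β : ℝ) (p : E3) :
    fderiv ℝ (casimir β) p (vectorField β p) = 0 := by
  rw [vectorField_eq_hamiltonianVectorField]
  exact fderiv_casimir_hamiltonianVectorField ..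

theorem fderiv_hamiltonian_vectorField (β : ℝ) (p : E3) :
    fderiv ℝ hamiltonian p (vectorField β p) = 0 := by
  rw [(hasFDerivAt_hamiltonian p).fderiv]
  simp [vectorField]
  ring

theorem HamiltonianStep.casimir_eq {β : ℝ} {a b : E3}
    (h : HamiltonianStep (fun _ => -1) (casimir β) a b) : casimir β b = casimir β a := by
  obtain ⟨f, -, γ, T, hT, hγ, rfl, rfl⟩ := h
  have hd : ∀ t ∈ Icc 0 T, HasDerivWithinAt (fun t => casimir β (γ t)) 0 (Icc 0 T) t := by
    intro t ht
    have := (hasFDerivAt_casimir β (γ t)).differentiableAt.hasFDerivAt.comp_hasDerivWithinAt t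
      (hγ t ht)
    rwa [fderiv_casimir_hamiltonianVectorField] at this
  refine constant_of_derivWithin_zero (fun t ht => (hd t ht).differentiableWithinAt)
    (fun t ht => ?_) T ⟨hT, le_rfl⟩
  exact (hd t (Ico_subset_Icc_self ht)).derivWithin
    (uniqueDiffOn_Icc (ht.1.trans_lt ht.2) t (Ico_subset_Icc_self ht))

theorem partials_linear (a b : ℝ) (p : E3) :
    partials (fun q : E3 => a * q 0 + b * q 1) p = ![a, b, 0] := by
  ext i
  have h := ((hasFDerivAt_coord 0 p).const_mul a).add ((hasFDerivAt_coord 1 p).const_mul b)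
  have h' : fderiv ℝ (fun q : E3 => a * q 0 + b * q 1) p = _ := h.fderiv
  rw [partials, h']
  fin_cases i <;> simp

/-- For a linear Hamiltonian in x and y, the components x' and y' are constant. The coefficients are
chosen so that (x', y') = (q 0, q 1); the (x, y)-projection is then a segment reaching `q` at time
1, and the Casimir forces z. -/
theorem hamiltonianStep_eqPoint {β : ℝ} (hβ : β ≠ 0) {M : ℝ} {q : E3}
    (hq : q ∈ leaf β (-β * M)) :
    HamiltonianStep (fun _ => -1) (casimir β) (eqPoint M) q := by
  rw [mem_leaf_iff hβ] at hq
  refine ⟨fun p => -(q 1) / β * p 0 + q 0 / β * p 1, ?_,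
    fun t => !₂[t * q 0, t * q 1, M + t ^ 2 * ((q 1 ^ 2 - q 0 ^ 2) / (4 * β))], 1, zero_le_one,
    ?_, ?_, ?_⟩
  · fun_prop
  · intro t _
    refine (hasDerivAt_E3_iff.2 fun i => ?_).hasDerivWithinAt
    simp only [hamiltonianVectorField, casimir_bracket_coord, partials_linear]
    fin_cases i
    · simpa [mul_div_cancel₀ _ hβ] using (hasDerivAt_id t).mul_const (q 0)
    · have := (hasDerivAt_id t).mul_const (q 1)
      simp at this ⊢
      exact this.congr_deriv (by field_simp)
    · have := (((hasDerivAt_id t).pow 2).mul_const ((q 1 ^ 2 - q 0 ^ 2) / (4 * β))).const_add M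
      simp at this ⊢
      exact this.congr_deriv (by field_simp; ring)
  · ext i
    fin_cases i <;> simp [eqPoint]
  · ext i
    fin_cases i <;> simp [hq]

theorem eqPoint_mem_leaf (β M : ℝ) : eqPoint M ∈ leaf β (-β * M) := by
  simp [leaf, casimir, eqPoint]

theorem vectorField_eqPoint (β M : ℝ) : vectorField β (eqPoint M) = 0 := by
  ext i
  fin_cases i <;> simp [vectorField, eqPoint]

theorem symplecticLeaf_eqPoint {β : ℝ} (hβ : β ≠ 0) (M : ℝ) :
    symplecticLeaf (fun _ => -1) (casimir β) (eqPoint M) = leaf β (-β * M) := by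
  apply Subset.antisymm
  · intro q hq
    have : casimir β q = casimir β (eqPoint M) := by
      induction hq with
      | refl => rfl
      | tail _ h ih => rw [h.casimir_eq, ih]
    rw [leaf, mem_ofPred_eq, this]
    exact eqPoint_mem_leaf β M
  · intro q hq
    exact Relation.ReflTransGen.single (hamiltonianStep_eqPoint hβ hq)

/-! ### The complete flow on the leaf -/

theorem contDiff_vectorField (β : ℝ) {n : WithTop ℕ∞} : ContDiff ℝ n (vectorField β) := by
  rw [contDiff_euclidean]
  intro i
  fin_cases i <;> simp [vectorField] <;> fun_prop

theorem isBounded_hamiltonian_le (c : ℝ) : Bornology.IsBounded {p : E3 | hamiltonian p ≤ c} := by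
  refine (Metric.isBounded_closedBall (x := (0 : E3)) (r := √(2 * c))).subset fun p hp => ?_
  rw [mem_closedBall_zero_iff]
  apply Real.le_sqrt_of_sq_le
  rw [EuclideanSpace.norm_sq_eq, Fin.sum_univ_three]
  simp only [mem_ofPred_eq, hamiltonian, Real.norm_eq_abs, sq_abs] at hp ⊢
  nlinarith [sq_nonneg (p 2)]

theorem differentiable_hamiltonian : Differentiable ℝ hamiltonian := fun p =>
  (hasFDerivAt_hamiltonian p).differentiableAt

theorem differentiable_casimir (β : ℝ) : Differentiable ℝ (casimir β) := fun p =>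
  (hasFDerivAt_casimir β p).differentiableAt

theorem exists_isFlowOn_leaf (β c : ℝ) : ∃ F, IsFlowOn (vectorField β) (leaf β c) F := by
  have h := exists_integralCurve_of_firstIntegral (contDiff_vectorField β)
    differentiable_hamiltonian (fderiv_hamiltonian_vectorField β) isBounded_hamiltonian_le
  choose γ h0 hγ using h
  refine ⟨fun t x => γ x t, fun t x hx => ?_, fun x _ => h0 x, fun x _ => hγ x⟩
  have := firstIntegral_const (differentiable_casimir β) (fderiv_casimir_vectorField β) (hγ x) t 0
  rw [h0] at this
  rw [leaf, mem_ofPred_eq] at hx ⊢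
  rw [this, hx]

variable {β c : ℝ} {F : ℝ → E3 → E3}

theorem IsFlowOn.hamiltonian_eq (hF : IsFlowOn (vectorField β) (leaf β c) F) {x : E3}
    (hx : x ∈ leaf β c) (t : ℝ) : hamiltonian (F t x) = hamiltonian x := by
  have := firstIntegral_const differentiable_hamiltonian (fderiv_hamiltonian_vectorField β)
    (hF.hasDerivAt x hx) t 0
  rwa [hF.map_zero x hx] at this

/-- Conservation of energy confines both curves to one bounded set, where uniqueness holds. Explicit
solutions can thus be identified with an arbitrary given flow. -/
theorem IsFlowOn.eq_integralCurve (hF : IsFlowOn (vectorField β) (leaf β c) F) {γ : ℝ → E3}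
    (hγ : ∀ t, HasDerivAt γ (vectorField β (γ t)) t) (h0 : γ 0 ∈ leaf β c) (t : ℝ) :
    F t (γ 0) = γ t := by
  refine congrFun (integralCurve_unique_of_isBounded (contDiff_vectorField β)
    (hF.hasDerivAt _ h0) hγ (isBounded_hamiltonian_le (hamiltonian (γ 0))) (t₀ := 0)
    (fun t => (hF.hamiltonian_eq h0 t).le) (fun t => ?_) (hF.map_zero _ h0)) t
  exact (firstIntegral_const differentiable_hamiltonian (fderiv_hamiltonian_vectorField β)
    hγ t 0).le

/-! ### The linear part at the equilibrium, and the leaf as a graph -/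

/-- The linear part of the Rikitake vector field at `(0, 0, M)`. -/
noncomputable def linearPart (β M : ℝ) : E3 →L[ℝ] E3 :=
  Matrix.toEuclideanCLM (𝕜 := ℝ) !![0, M + β, 0; M - β, 0, 0; 0, 0, 0]

theorem linearPart_apply (β M : ℝ) (v : E3) :
    linearPart β M v = !₂[(M + β) * v 1, (M - β) * v 0, 0] := by
  ext i
  rw [linearPart, Matrix.ofLp_toEuclideanCLM]
  fin_cases i <;> simp [Matrix.mulVec, dotProduct, Fin.sum_univ_three]

/-- The field is quadratic, so the remainder is exactly (yz, xz, -xy). -/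
theorem norm_vectorField_sub_linearPart_le (β M : ℝ) (y : E3) :
    ‖vectorField β (eqPoint M + y) - linearPart β M y‖ ≤ 1 * ‖y‖ ^ 2 := by
  have h : vectorField β (eqPoint M + y) - linearPart β M y =
      !₂[y 1 * y 2, y 0 * y 2, -(y 0 * y 1)] := by
    ext i
    rw [linearPart_apply]
    fin_cases i <;> simp [vectorField, eqPoint] <;> ring
  rw [h, one_mul]
  refine le_of_sq_le_sq ?_ (by positivity)
  rw [EuclideanSpace.norm_sq_eq, EuclideanSpace.norm_sq_eq, Fin.sum_univ_three,
    Fin.sum_univ_three]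
  simp only [Real.norm_eq_abs, sq_abs]
  simp
  nlinarith [sq_nonneg (y 0 * y 1), sq_nonneg (y 0 * y 2), sq_nonneg (y 1 * y 2),
    sq_nonneg (y 0 ^ 2), sq_nonneg (y 1 ^ 2), sq_nonneg (y 2 ^ 2)]

/-- The leaf through `(0, 0, M)` is the graph of this function of `(x, y)`. -/
noncomputable def graphPoint (β M x y : ℝ) : E3 := !₂[x, y, M + (y ^ 2 - x ^ 2) / (4 * β)]

theorem graphPoint_zero (β M : ℝ) : graphPoint β M 0 0 = eqPoint M := by
  simp [graphPoint, eqPoint]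

theorem graphPoint_mem_leaf {β : ℝ} (hβ : β ≠ 0) (M x y : ℝ) :
    graphPoint β M x y ∈ leaf β (-β * M) := by
  rw [mem_leaf_iff hβ]
  simp [graphPoint]

theorem eq_graphPoint_of_mem_leaf {β : ℝ} (hβ : β ≠ 0) {M : ℝ} {p : E3}
    (hp : p ∈ leaf β (-β * M)) : p = graphPoint β M (p 0) (p 1) := by
  rw [mem_leaf_iff hβ] at hp
  ext i
  fin_cases i <;> simp [graphPoint, hp]

theorem continuous_graphPoint (β M : ℝ) :
    Continuous fun v : ℝ × ℝ => graphPoint β M v.1 v.2 := by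
  refine (PiLp.continuous_toLp 2 _).comp (continuous_pi fun i => ?_)
  fin_cases i <;> simp <;> fun_prop

theorem fderiv_casimir_eqPoint (β M : ℝ) (v : E3) :
    fderiv ℝ (casimir β) (eqPoint M) v = -β * v 2 := by
  rw [(hasFDerivAt_casimir β _).fderiv]
  simp [eqPoint]

theorem mem_tangentSpace_iff {β : ℝ} (hβ : β ≠ 0) {M : ℝ} {v : E3} :
    v ∈ tangentSpace (casimir β) (eqPoint M) ↔ v 2 = 0 := by
  rw [LinearMap.mem_ker, ContinuousLinearMap.coe_coe, fderiv_casimir_eqPoint]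
  simp [hβ]

theorem hasDerivAt_graphPoint_line {β M : ℝ} {v : E3} (hv : v 2 = 0) :
    HasDerivAt (fun s => graphPoint β M (s * v 0) (s * v 1)) v 0 := by
  refine hasDerivAt_E3_iff.2 fun i => ?_
  fin_cases i
  · simpa [graphPoint] using (hasDerivAt_id (0 : ℝ)).mul_const (v 0)
  · simpa [graphPoint] using (hasDerivAt_id (0 : ℝ)).mul_const (v 1)
  · have := (((((hasDerivAt_id (0 : ℝ)).mul_const (v 1)).pow 2).sub
      (((hasDerivAt_id (0 : ℝ)).mul_const (v 0)).pow 2)).div_const (4 * β)).const_add M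
    simp at this
    simpa [graphPoint, hv] using this

/-! ### Linearization on the leaf -/

section Linearization

variable {β M : ℝ} {F : ℝ → E3 → E3}

theorem IsFlowOn.hasFDerivWithinAt_eqPoint
    (hF : IsFlowOn (vectorField β) (leaf β (-β * M)) F) (t : ℝ) :
    HasFDerivWithinAt (F t) (NormedSpace.exp (t • linearPart β M)) (leaf β (-β * M))
      (eqPoint M) := by
  set c := hamiltonian (eqPoint M) + 1
  obtain ⟨R, hR⟩ := (isBounded_hamiltonian_le c).subset_closedBall 0
  obtain ⟨K, hK⟩ :=
    ContDiff.exists_lipschitzOnWith_closedBall (contDiff_vectorField β (n := 1)) 0 R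
  refine hasFDerivWithinAt_flow (norm_vectorField_sub_linearPart_le β M) (hK.mono hR)
    (eqPoint_mem_leaf β M) ?_ hF.map_zero hF.hasDerivAt ?_ t
  · simp [c]
  · have hc : ∀ᶠ x in 𝓝 (eqPoint M), hamiltonian x < c :=
      differentiable_hamiltonian.continuous.continuousAt.eventually_lt continuousAt_const
        (by simp [c])
    filter_upwards [hc.filter_mono nhdsWithin_le_nhds, self_mem_nhdsWithin] with x hx hxS t
    rw [hF.hamiltonian_eq hxS]
    exact hx.le

/-- A derivative within the leaf is determined only on tangent vectors. Differentiating along the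
lift of a line in the (x, y)-plane to the leaf shows that every admissible `D t` agrees there with
exp(tA). -/
theorem IsFlowOn.isLinearizationOn_iff (hβ : β ≠ 0)
    (hF : IsFlowOn (vectorField β) (leaf β (-β * M)) F)
    (L : tangentSpace (casimir β) (eqPoint M) →ₗ[ℝ] tangentSpace (casimir β) (eqPoint M)) :
    IsLinearizationOn F (leaf β (-β * M)) (casimir β) (eqPoint M) L ↔
      ∀ v, (L v : E3) = linearPart β M v := by
  constructor
  · rintro ⟨D, hD, hL⟩ v
    have hv : (v : E3) 2 = 0 := (mem_tangentSpace_iff hβ).1 v.2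
    have hD' : ∀ t, D t v = NormedSpace.exp (t • linearPart β M) (v : E3) := by
      intro t
      have hc := (hasDerivAt_graphPoint_line (β := β) (M := M) hv).hasDerivWithinAt (s := univ)
      have hp : graphPoint β M (0 * (v : E3) 0) (0 * (v : E3) 1) = eqPoint M := by
        rw [zero_mul, zero_mul, graphPoint_zero]
      have hm : MapsTo (fun s => graphPoint β M (s * (v : E3) 0) (s * (v : E3) 1)) univ
        (leaf β (-β * M)) := fun s _ => graphPoint_mem_leaf hβ ..
      have h1 := HasFDerivWithinAt.comp_hasDerivWithinAt (0 : ℝ) (hp ▸ hD t) hc hm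
      have h2 := HasFDerivWithinAt.comp_hasDerivWithinAt (0 : ℝ)
        (hp ▸ hF.hasFDerivWithinAt_eqPoint t) hc hm
      rw [hasDerivWithinAt_univ] at h1 h2
      exact h1.unique h2
    have h := hL v
    simp only [hD'] at h
    exact h.unique (hasDerivAt_exp_smul_apply_zero _ _)
  · intro hL
    refine ⟨_, hF.hasFDerivWithinAt_eqPoint, fun v => ?_⟩
    rw [hL]
    exact hasDerivAt_exp_smul_apply_zero _ _

theorem linearPart_mem_tangentSpace (hβ : β ≠ 0) (v : E3) :
    linearPart β M v ∈ tangentSpace (casimir β) (eqPoint M) := by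
  rw [mem_tangentSpace_iff hβ, linearPart_apply]
  simp

theorem IsFlowOn.existsUnique_isLinearizationOn (hβ : β ≠ 0)
    (hF : IsFlowOn (vectorField β) (leaf β (-β * M)) F) :
    ∃! L, IsLinearizationOn F (leaf β (-β * M)) (casimir β) (eqPoint M) L := by
  refine ⟨(linearPart β M : E3 →ₗ[ℝ] E3).restrict
    fun v _ => linearPart_mem_tangentSpace hβ v, ?_, fun L hL => ?_⟩
  · exact (hF.isLinearizationOn_iff hβ _).2 fun v => rfl
  · replace hL := (hF.isLinearizationOn_iff hβ L).1 hL
    ext v : 2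
    exact hL v

/-- The coordinates `(x, y)` on the tangent space of the leaf at `(0, 0, M)`. -/
noncomputable def tangentCoords (hβ : β ≠ 0) (M : ℝ) :
    tangentSpace (casimir β) (eqPoint M) ≃ₗ[ℝ] (Fin 2 → ℝ) where
  toFun v := ![(v : E3) 0, (v : E3) 1]
  map_add' v w := by
    ext i
    fin_cases i <;> simp
  map_smul' r v := by
    ext i
    fin_cases i <;> simp
  invFun w := ⟨!₂[w 0, w 1, 0], (mem_tangentSpace_iff hβ).2 (by simp)⟩
  left_inv v := by
    have hv := (mem_tangentSpace_iff hβ).1 v.2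
    ext i
    fin_cases i <;> simp [hv]
  right_inv w := by
    ext i
    fin_cases i <;> simp

theorem IsFlowOn.charpoly_linearization (hβ : β ≠ 0)
    (hF : IsFlowOn (vectorField β) (leaf β (-β * M)) F)
    {L : tangentSpace (casimir β) (eqPoint M) →ₗ[ℝ] tangentSpace (casimir β) (eqPoint M)}
    (hL : IsLinearizationOn F (leaf β (-β * M)) (casimir β) (eqPoint M) L) :
    L.charpoly = Polynomial.X ^ 2 + Polynomial.C (β ^ 2 - M ^ 2) := by
  rw [hF.isLinearizationOn_iff hβ] at hL
  have h : (tangentCoords hβ M).conj L = Matrix.toLin' !![0, M + β; M - β, 0] := by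
    refine LinearMap.ext fun w => ?_
    ext i
    have := hL ((tangentCoords hβ M).symm w)
    rw [linearPart_apply] at this
    rw [LinearEquiv.conj_apply_apply]
    change ![(L ((tangentCoords hβ M).symm w) : E3) 0, (L ((tangentCoords hβ M).symm w) : E3) 1] i
      = _
    rw [this]
    fin_cases i <;> simp [tangentCoords, Matrix.mulVec, dotProduct]
  rw [← (tangentCoords hβ M).charpoly_conj L, h, Matrix.charpoly_toLin', Matrix.charpoly_fin_two]
  simp [Matrix.trace_fin_two, Matrix.det_fin_two]
  ring

end Linearization

/-! ### Instability and Lyapunov stability -/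

section Stability

variable {β M : ℝ} {F : ℝ → E3 → E3}

theorem IsFlowOn.hasDerivAt_mul_coords {c : ℝ} (hF : IsFlowOn (vectorField β) (leaf β c) F)
    {x : E3} (hx : x ∈ leaf β c) (t : ℝ) :
    HasDerivAt (fun s => F s x 0 * F s x 1)
      (F t x 1 ^ 2 * (F t x 2 + β) + F t x 0 ^ 2 * (F t x 2 - β)) t := by
  have h := hasDerivAt_E3_iff.1 (hF.hasDerivAt x hx t)
  refine ((h 0).mul (h 1)).congr_deriv ?_
  simp [vectorField]
  ring

/-- Chetaev's argument with the function `± xy`. -/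
theorem IsFlowOn.not_lyapunovStableOn (hβ : β ≠ 0)
    (hF : IsFlowOn (vectorField β) (leaf β (-β * M)) F) (hM : |β| < |M|) :
    ¬ LyapunovStableOn F (leaf β (-β * M)) (eqPoint M) := by
  intro hst
  obtain ⟨σ, hσ, hσM⟩ : ∃ σ : ℝ, σ ^ 2 = 1 ∧ σ * M = |M| := by
    rcases abs_cases M with h | h
    · exact ⟨1, by norm_num, by rw [h.1, one_mul]⟩
    · exact ⟨-1, by norm_num, by rw [h.1, neg_one_mul]⟩
  have hσ' : |σ| = 1 := by
    rw [← Real.sqrt_sq_eq_abs, hσ, Real.sqrt_one]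
  -- While |z - M| < δ, both σ(z + β) and σ(z - β) are at least |M| - |β| - δ = δ.
  set δ := (|M| - |β|) / 2 with hδ
  have hδ0 : 0 < δ := by rw [hδ]; linarith
  set U : Set E3 := {p | |p 2 - M| < δ} ∩ {p | |p 0| < 1} ∩ {p | |p 1| < 1} with hU
  have hcoord : ∀ i : Fin 3, Continuous fun p : E3 => p i := fun i => by fun_prop
  have hUo : IsOpen U := by
    refine ((isOpen_lt ?_ continuous_const).inter (isOpen_lt ?_ continuous_const)).inter
      (isOpen_lt ?_ continuous_const)
    · exact ((hcoord 2).sub continuous_const).abs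
    · exact (hcoord 0).abs
    · exact (hcoord 1).abs
  have hpU : eqPoint M ∈ U := by simp [hU, eqPoint, hδ0]
  obtain ⟨V, hVo, hpV, -, hV⟩ := hst U hUo hpU
  -- On the ray y = σx the function σxy is positive: it starts at s².
  obtain ⟨s, hs0, hsV⟩ : ∃ s : ℝ, 0 < s ∧ graphPoint β M s (σ * s) ∈ V := by
    have hc : Continuous fun s : ℝ => graphPoint β M s (σ * s) :=
      (continuous_graphPoint β M).comp (f := fun s : ℝ => (s, σ * s)) (by fun_prop)
    have h0 : V ∈ 𝓝 (graphPoint β M 0 (σ * 0)) := by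
      rw [mul_zero, graphPoint_zero]
      exact hVo.mem_nhds hpV
    have h1 : ∀ᶠ s in 𝓝[>] (0 : ℝ), graphPoint β M s (σ * s) ∈ V :=
      (hc.continuousAt.eventually_mem h0).filter_mono nhdsWithin_le_nhds
    obtain ⟨s, hs, hs'⟩ := (h1.and self_mem_nhdsWithin).exists
    exact ⟨s, hs', hs⟩
  set x := graphPoint β M s (σ * s) with hx
  have hxS : x ∈ leaf β (-β * M) := graphPoint_mem_leaf hβ ..
  set w : ℝ → ℝ := fun t => σ * (F t x 0 * F t x 1) with hw
  have hwd : ∀ t, HasDerivAt w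
      (σ * (F t x 1 ^ 2 * (F t x 2 + β) + F t x 0 ^ 2 * (F t x 2 - β))) t := fun t =>
    (hF.hasDerivAt_mul_coords hxS t).const_mul σ
  have hFU : ∀ t, 0 ≤ t → F t x ∈ U := fun t ht => (hV x ⟨hsV, hxS⟩ t ht).1
  have hw0 : w 0 = s ^ 2 := by
    simp only [hw, hF.map_zero x hxS]
    simp only [hx, graphPoint]
    simp
    linear_combination s ^ 2 * hσ
  have hge : ∀ t, 0 ≤ t →
      2 * δ * w t ≤ σ * (F t x 1 ^ 2 * (F t x 2 + β) + F t x 0 ^ 2 * (F t x 2 - β)) := by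
    intro t ht
    obtain ⟨⟨hz, -⟩, -⟩ := hFU t ht
    rw [mem_ofPred_eq] at hz
    have hσz : |σ * (F t x 2 - M)| < δ := by rw [abs_mul, hσ', one_mul]; exact hz
    have hσβ : |σ * β| = |β| := by rw [abs_mul, hσ', one_mul]
    have h1 := (abs_lt.1 hσz).1
    have h2 := abs_le.1 hσβ.le
    have hp : δ ≤ σ * (F t x 2 + β) := by nlinarith [h2.1, h2.2]
    have hm : δ ≤ σ * (F t x 2 - β) := by nlinarith [h2.1, h2.2]
    have hsq : 2 * w t ≤ F t x 1 ^ 2 + F t x 0 ^ 2 := by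
      have h3 : F t x 0 ^ 2 = (σ * F t x 0) ^ 2 := by rw [mul_pow, hσ, one_mul]
      rw [h3]
      simp only [hw]
      nlinarith [sq_nonneg (F t x 1 - σ * F t x 0)]
    nlinarith [mul_le_mul_of_nonneg_left hp (sq_nonneg (F t x 1)),
      mul_le_mul_of_nonneg_left hm (sq_nonneg (F t x 0))]
  have hwlt : ∀ t, 0 ≤ t → w t < 1 := by
    intro t ht
    obtain ⟨⟨-, h0⟩, h1⟩ := hFU t ht
    rw [mem_ofPred_eq] at h0 h1
    calc w t ≤ |w t| := le_abs_self _
      _ = |F t x 0| * |F t x 1| := by rw [hw, abs_mul, hσ', one_mul, abs_mul]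
      _ < 1 := by nlinarith [abs_nonneg (F t x 0), abs_nonneg (F t x 1)]
  -- Integrated form of w' ≥ 2δw; the resulting exponential growth contradicts w < 1.
  have hexp : MonotoneOn (fun t => w t * Real.exp (-(2 * δ) * t)) (Ici 0) := by
    have hd : ∀ t, HasDerivAt (fun t => w t * Real.exp (-(2 * δ) * t)) _ t := fun t =>
      (hwd t).mul (((hasDerivAt_id t).const_mul (-(2 * δ))).exp)
    refine monotoneOn_of_deriv_nonneg (convex_Ici 0)
      (fun t _ => (hd t).continuousAt.continuousWithinAt)
      (fun t _ => (hd t).differentiableAt.differentiableWithinAt) fun t ht => ?_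
    rw [interior_Ici] at ht
    rw [(hd t).deriv]
    have := mul_le_mul_of_nonneg_right (hge t ht.le) (Real.exp_pos (-(2 * δ) * t)).le
    simp only [id_eq, mul_one]
    linarith
  obtain ⟨t, ht0, ht⟩ : ∃ t : ℝ, 0 ≤ t ∧ 1 ≤ s ^ 2 * Real.exp (2 * δ * t) := by
    have h1 : Tendsto (fun t : ℝ => s ^ 2 * Real.exp (2 * δ * t)) atTop atTop :=
      (Real.tendsto_exp_atTop.comp (tendsto_id.const_mul_atTop (by positivity))).const_mul_atTop
        (by positivity)
    obtain ⟨t, h⟩ := ((eventually_ge_atTop 0).and (h1.eventually_ge_atTop 1)).exists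
    exact ⟨t, h⟩
  have h1 := hexp (mem_Ici.2 le_rfl) (mem_Ici.2 ht0) ht0
  simp only [hw0, mul_zero, Real.exp_zero, mul_one] at h1
  have h2 := mul_le_mul_of_nonneg_right h1 (Real.exp_pos (2 * δ * t)).le
  rw [mul_assoc (w t), ← Real.exp_add, neg_mul, neg_add_cancel, Real.exp_zero, mul_one] at h2
  linarith [hwlt t ht0]

/-- The cross term 2M(z - M) of z² shifts the coefficients of x² and y² away from 1/2. The result is
a quadratic form, definite for |M| < |β|, plus a square. -/
theorem hamiltonian_graphPoint (hβ : β ≠ 0) (M x y : ℝ) :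
    hamiltonian (graphPoint β M x y) = M ^ 2 + ((β - M) / (2 * β) * x ^ 2 +
      (β + M) / (2 * β) * y ^ 2 + ((y ^ 2 - x ^ 2) / (4 * β)) ^ 2) := by
  simp [hamiltonian, graphPoint]
  field_simp
  ring

theorem sub_div_pos_of_abs_lt (h : |M| < |β|) : 0 < (β - M) / (2 * β) := by
  rcases abs_cases M with hM | hM <;> rcases abs_cases β with hb | hb <;>
    first
    | exact div_pos (by linarith) (by linarith)
    | exact div_pos_of_neg_of_neg (by linarith) (by linarith)

theorem add_div_pos_of_abs_lt (h : |M| < |β|) : 0 < (β + M) / (2 * β) := by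
  rw [← sub_neg_eq_add]
  exact sub_div_pos_of_abs_lt (by rwa [abs_neg])

/-- On the leaf, the Hamiltonian has a strict minimum at `(0, 0, M)`, and its sublevel sets
shrink to this point. -/
theorem exists_hamiltonian_lt_subset (h : |M| < |β|) {U : Set E3} (hU : U ∈ 𝓝 (eqPoint M)) :
    ∃ δ > 0, ∀ q ∈ leaf β (-β * M), hamiltonian q < M ^ 2 + δ → q ∈ U := by
  have hβ : β ≠ 0 := abs_pos.1 ((abs_nonneg M).trans_lt h)
  have ha := sub_div_pos_of_abs_lt h
  have hb := add_div_pos_of_abs_lt h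
  set a := (β - M) / (2 * β)
  set b := (β + M) / (2 * β)
  have hU' : (fun v : ℝ × ℝ => graphPoint β M v.1 v.2) ⁻¹' U ∈ 𝓝 ((0 : ℝ), (0 : ℝ)) := by
    refine (continuous_graphPoint β M).continuousAt.preimage_mem_nhds ?_
    rwa [graphPoint_zero]
  obtain ⟨r, hr, hrU⟩ := Metric.mem_nhds_iff.1 hU'
  -- Dropping the quartic square and one of the two quadratic terms bounds each coordinate by `r`.
  refine ⟨min a b * r ^ 2, by positivity, fun q hq hH => ?_⟩
  rw [eq_graphPoint_of_mem_leaf hβ hq] at hH ⊢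
  rw [hamiltonian_graphPoint hβ] at hH
  have hm1 : min a b * q 0 ^ 2 ≤ a * q 0 ^ 2 := by gcongr; exact min_le_left ..
  have hm2 : min a b * q 1 ^ 2 ≤ b * q 1 ^ 2 := by gcongr; exact min_le_right ..
  have hmin : 0 < min a b := lt_min ha hb
  have h0 : q 0 ^ 2 < r ^ 2 := by
    refine lt_of_mul_lt_mul_left (a := min a b) ?_ hmin.le
    nlinarith [sq_nonneg ((q 1 ^ 2 - q 0 ^ 2) / (4 * β)), mul_nonneg hb.le (sq_nonneg (q 1))]
  have h1 : q 1 ^ 2 < r ^ 2 := by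
    refine lt_of_mul_lt_mul_left (a := min a b) ?_ hmin.le
    nlinarith [sq_nonneg ((q 1 ^ 2 - q 0 ^ 2) / (4 * β)), mul_nonneg ha.le (sq_nonneg (q 0))]
  refine @hrU (q 0, q 1) ?_
  rw [Metric.mem_ball, Prod.dist_eq, max_lt_iff, Real.dist_eq, Real.dist_eq, sub_zero, sub_zero]
  exact ⟨abs_lt_of_sq_lt_sq h0 hr.le, abs_lt_of_sq_lt_sq h1 hr.le⟩

theorem hamiltonian_eqPoint (M : ℝ) : hamiltonian (eqPoint M) = M ^ 2 := by
  simp [hamiltonian, eqPoint]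

theorem IsFlowOn.lyapunovStableOn (hF : IsFlowOn (vectorField β) (leaf β (-β * M)) F)
    (h : |M| < |β|) : LyapunovStableOn F (leaf β (-β * M)) (eqPoint M) := by
  intro U hUo hpU
  obtain ⟨δ, hδ, hU⟩ := exists_hamiltonian_lt_subset h (hUo.mem_nhds hpU)
  refine ⟨{q | hamiltonian q < M ^ 2 + δ},
    isOpen_lt differentiable_hamiltonian.continuous continuous_const, ?_, ?_, ?_⟩
  · simpa [hamiltonian_eqPoint] using hδ
  · exact fun q hq => ⟨hU q hq.2 hq.1, hq.2⟩
  · intro x hx t _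
    have hS := hF.mapsTo t hx.2
    refine ⟨hU _ hS ?_, hS⟩
    rw [hF.hamiltonian_eq hx.2]
    exact hx.1

end Stability

/-! ### Scalar periodic equations -/

/-- The time-angle correspondence for the scalar equation `φ' = f φ` with `f` positive and
periodic. -/
theorem exists_orderIso_integral_inv {f : ℝ → ℝ} (hf : Continuous f) (hpos : ∀ φ, 0 < f φ) {P : ℝ}
    (hper : Function.Periodic f P) (hP : 0 < P) :
    ∃ e : ℝ ≃o ℝ, (∀ φ, e φ = ∫ ψ in (0 : ℝ)..φ, (f ψ)⁻¹) ∧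
      (∀ s, HasDerivAt e.symm (f (e.symm s)) s) ∧ ∀ φ, e (φ + P) = e φ + e P := by
  have hc : Continuous fun ψ => (f ψ)⁻¹ := hf.inv₀ fun ψ => (hpos ψ).ne'
  have hpos' : ∀ ψ, 0 < (f ψ)⁻¹ := fun ψ => inv_pos.2 (hpos ψ)
  have hper' : Function.Periodic (fun ψ => (f ψ)⁻¹) P := fun ψ => by simp only [hper ψ]
  have hd : ∀ φ, HasDerivAt (fun φ => ∫ ψ in (0 : ℝ)..φ, (f ψ)⁻¹) (f φ)⁻¹ φ := fun φ =>
    hc.integral_hasStrictDerivAt 0 φ |>.hasDerivAt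
  have hmono : StrictMono fun φ => ∫ ψ in (0 : ℝ)..φ, (f ψ)⁻¹ :=
    strictMono_of_deriv_pos fun φ => by rw [(hd φ).deriv]; exact hpos' φ
  -- The integral of a positive periodic function diverges in both directions.
  have hsurj : Function.Surjective fun φ => ∫ ψ in (0 : ℝ)..φ, (f ψ)⁻¹ :=
    Continuous.surjective (continuous_iff_continuousAt.2 fun φ => (hd φ).continuousAt)
      (hper'.tendsto_atTop_intervalIntegral_of_pos' (hc.intervalIntegrable ..) hpos' hP)
      (hper'.tendsto_atBot_intervalIntegral_of_pos' (hc.intervalIntegrable ..) hpos' hP)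
  let e := hmono.orderIsoOfSurjective _ hsurj
  refine ⟨e, fun φ => rfl, fun s => ?_, fun φ => ?_⟩
  · have h1 : HasDerivAt e (f (e.symm s))⁻¹ (e.symm s) := hd _
    have h2 := HasDerivAt.of_local_left_inverse e.symm.continuous.continuousAt h1
      (hpos' _).ne' (Eventually.of_forall fun y => e.apply_symm_apply y)
    rwa [inv_inv] at h2
  · have := hper'.intervalIntegral_add_eq_add 0 φ fun _ _ => hc.intervalIntegrable ..
    simp only [zero_add] at this
    exact this

theorem hasDerivAt_graphPoint {β M : ℝ} (hβ : β ≠ 0) {x y : ℝ → ℝ} {t : ℝ}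
    (hx : HasDerivAt x (y t * (M + (y t ^ 2 - x t ^ 2) / (4 * β) + β)) t)
    (hy : HasDerivAt y (x t * (M + (y t ^ 2 - x t ^ 2) / (4 * β) - β)) t) :
    HasDerivAt (fun s => graphPoint β M (x s) (y s))
      (vectorField β (graphPoint β M (x t) (y t))) t := by
  refine hasDerivAt_E3_iff.2 fun i => ?_
  fin_cases i
  · refine hx.congr_deriv ?_
    simp [vectorField, graphPoint]
    ring
  · refine hy.congr_deriv ?_
    simp [vectorField, graphPoint]
    ring
  · refine ((((hy.pow 2).sub (hx.pow 2)).div_const (4 * β)).const_add M).congr_deriv ?_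
    simp [vectorField, graphPoint]
    field_simp
    ring

/-! ### Energy levels in elliptic polar coordinates -/

noncomputable section Polar

/-- `z - M` on the leaf, divided by the square of the radius, as a function of the angle, for the
elliptic polar coordinates `x = A r cos φ`, `y = B r sin φ`. -/
def heightShape (β A B φ : ℝ) : ℝ := ((B * Real.sin φ) ^ 2 - (A * Real.cos φ) ^ 2) / (4 * β)

/-- The angular speed on the orbit of energy `M² + ε²`, up to a constant factor. -/
def angularSpeed (β A B ε φ : ℝ) : ℝ := √(1 + (2 * ε * heightShape β A B φ) ^ 2)

/-- The radius on the orbit of energy `M² + ε²`. -/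
def orbitRadius (β A B ε φ : ℝ) : ℝ := ε * √(2 / (1 + angularSpeed β A B ε φ))

/-- The point with angle `φ` on the orbit of energy `M² + ε²`. -/
def orbitPoint (β M A B ε φ : ℝ) : E3 :=
  graphPoint β M (A * (orbitRadius β A B ε φ * Real.cos φ))
    (B * (orbitRadius β A B ε φ * Real.sin φ))

variable {β M A B ε φ : ℝ}

theorem angularSpeed_pos : 0 < angularSpeed β A B ε φ := Real.sqrt_pos.2 (by positivity)

theorem angularSpeed_sq :
    angularSpeed β A B ε φ ^ 2 = 1 + (2 * ε * heightShape β A B φ) ^ 2 :=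
  Real.sq_sqrt (by positivity)

theorem orbitRadius_pos (hε : 0 < ε) : 0 < orbitRadius β A B ε φ :=
  mul_pos hε (Real.sqrt_pos.2 (div_pos two_pos (add_pos one_pos angularSpeed_pos)))

theorem orbitRadius_sq :
    orbitRadius β A B ε φ ^ 2 = 2 * ε ^ 2 / (1 + angularSpeed β A B ε φ) := by
  have h : 0 < 1 + angularSpeed β A B ε φ := add_pos one_pos angularSpeed_pos
  rw [orbitRadius, mul_pow, Real.sq_sqrt (by positivity)]
  ring

/-- With q = `heightShape`, the square of the radius is the positive root u of q²u² + u - ε². The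
angular speed is the square root of the discriminant, hence the derivative 1 + 2q²u at that root. -/
theorem angularSpeed_eq : angularSpeed β A B ε φ =
    1 + 2 * heightShape β A B φ ^ 2 * orbitRadius β A B ε φ ^ 2 := by
  have h : 0 < 1 + angularSpeed β A B ε φ := add_pos one_pos angularSpeed_pos
  rw [orbitRadius_sq]
  field_simp
  linear_combination angularSpeed_sq (β := β) (A := A) (B := B) (ε := ε) (φ := φ)

/-- The radius is defined by the rationalised root 2ε²/(1 + g), which remains meaningful at angles
where q = 0. -/
theorem orbitRadius_energy : orbitRadius β A B ε φ ^ 2 +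
    heightShape β A B φ ^ 2 * orbitRadius β A B ε φ ^ 4 = ε ^ 2 := by
  have h : 0 < 1 + angularSpeed β A B ε φ := add_pos one_pos angularSpeed_pos
  have h1 := orbitRadius_sq (β := β) (A := A) (B := B) (ε := ε) (φ := φ)
  have h2 := angularSpeed_eq (β := β) (A := A) (B := B) (ε := ε) (φ := φ)
  rw [eq_div_iff h.ne'] at h1
  linear_combination h1 / 2 - orbitRadius β A B ε φ ^ 2 / 2 * h2

theorem heightShape_periodic : Function.Periodic (heightShape β A B) (2 * Real.pi) := fun φ => by
  simp [heightShape]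

theorem angularSpeed_periodic : Function.Periodic (angularSpeed β A B ε) (2 * Real.pi) :=
  fun φ => by rw [angularSpeed, angularSpeed, heightShape_periodic]

theorem orbitPoint_periodic : Function.Periodic (orbitPoint β M A B ε) (2 * Real.pi) := fun φ => by
  simp only [orbitPoint, orbitRadius, angularSpeed_periodic φ, Real.cos_add_two_pi,
    Real.sin_add_two_pi]

theorem continuous_angularSpeed :
    Continuous fun v : ℝ × ℝ => angularSpeed β A B v.1 v.2 := by
  unfold angularSpeed heightShape
  fun_prop

theorem continuous_orbitPoint (φ : ℝ) : Continuous fun ε => orbitPoint β M A B ε φ := by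
  have h : Continuous fun ε => angularSpeed β A B ε φ :=
    continuous_angularSpeed.comp (f := fun ε : ℝ => (ε, φ)) (by fun_prop)
  have hr : Continuous fun ε => orbitRadius β A B ε φ :=
    continuous_id.mul (continuous_const.div (continuous_const.add h)
      fun ε => (add_pos one_pos angularSpeed_pos).ne').sqrt
  exact (continuous_graphPoint β M).comp (f := fun ε =>
    (A * (orbitRadius β A B ε φ * Real.cos φ), B * (orbitRadius β A B ε φ * Real.sin φ)))
    (by fun_prop)

theorem hasDerivAt_heightShape (φ : ℝ) : HasDerivAt (heightShape β A B)
    (Real.sin φ * Real.cos φ * (A ^ 2 + B ^ 2) / (2 * β)) φ := by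
  refine (((((Real.hasDerivAt_sin φ).const_mul B).pow 2).sub
    (((Real.hasDerivAt_cos φ).const_mul A).pow 2)).div_const (4 * β)).congr_deriv ?_
  simp
  ring

theorem hasDerivAt_angularSpeed (φ : ℝ) : HasDerivAt (angularSpeed β A B ε)
    (4 * ε ^ 2 * heightShape β A B φ *
      (Real.sin φ * Real.cos φ * (A ^ 2 + B ^ 2) / (2 * β)) / angularSpeed β A B ε φ) φ := by
  have h := (((hasDerivAt_heightShape (β := β) (A := A) (B := B) φ).const_mul (2 * ε)).pow
    2).const_add 1
  refine (h.sqrt (by simp only [Pi.pow_apply]; positivity)).congr_deriv ?_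
  rw [angularSpeed]
  simp
  ring

/-- With respect to the angle, `r' = -q q' r³ / g` where `q` is `heightShape` and `g` is
`angularSpeed`. -/
theorem hasDerivAt_orbitRadius (hε : 0 < ε) (φ : ℝ) : HasDerivAt (orbitRadius β A B ε)
    (-(heightShape β A B φ * (Real.sin φ * Real.cos φ * (A ^ 2 + B ^ 2) / (2 * β)) *
      orbitRadius β A B ε φ ^ 3) / angularSpeed β A B ε φ) φ := by
  have hg : 0 < angularSpeed β A B ε φ := angularSpeed_pos
  have hr : 0 < orbitRadius β A B ε φ := orbitRadius_pos hε
  have h := ((hasDerivAt_const φ (2 * ε ^ 2)).div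
    ((hasDerivAt_angularSpeed (β := β) (A := A) (B := B) (ε := ε) φ).const_add 1)
    (by positivity)).sqrt (by simp only [Pi.div_apply]; positivity)
  have he : orbitRadius β A B ε = fun φ => √(2 * ε ^ 2 / (1 + angularSpeed β A B ε φ)) := by
    ext ψ
    rw [← orbitRadius_sq, Real.sqrt_sq (orbitRadius_pos hε).le]
  have hr1 : √(2 * ε ^ 2 / (1 + angularSpeed β A B ε φ)) = orbitRadius β A B ε φ :=
    (congrFun he φ).symm
  have hr2 := orbitRadius_sq (β := β) (A := A) (B := B) (ε := ε) (φ := φ)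
  have hr4 : orbitRadius β A B ε φ ^ 4 = (2 * ε ^ 2 / (1 + angularSpeed β A B ε φ)) ^ 2 := by
    rw [← hr2]
    ring
  refine (he ▸ h).congr_deriv ?_
  simp only [Pi.div_apply]
  rw [hr1, zero_mul, zero_sub, div_eq_div_iff (by positivity) hg.ne']
  have : -(heightShape β A B φ * (Real.sin φ * Real.cos φ * (A ^ 2 + B ^ 2) / (2 * β)) *
      orbitRadius β A B ε φ ^ 3) * (2 * orbitRadius β A B ε φ) =
    -(heightShape β A B φ * (Real.sin φ * Real.cos φ * (A ^ 2 + B ^ 2) / (2 * β))) * 2 *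
      orbitRadius β A B ε φ ^ 4 := by ring
  rw [this, hr4]
  field_simp
  ring

theorem orbitPoint_mem_leaf (hβ : β ≠ 0) : orbitPoint β M A B ε φ ∈ leaf β (-β * M) :=
  graphPoint_mem_leaf hβ ..

theorem hamiltonian_polar (hβ : β ≠ 0) (hA : A ^ 2 * (β - M) = 2 * β)
    (hB : B ^ 2 * (β + M) = 2 * β) (r φ : ℝ) :
    hamiltonian (graphPoint β M (A * (r * Real.cos φ)) (B * (r * Real.sin φ))) =
      M ^ 2 + (r ^ 2 + heightShape β A B φ ^ 2 * r ^ 4) := by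
  rw [hamiltonian_graphPoint hβ, heightShape]
  have h : (β - M) / (2 * β) * (A * (r * Real.cos φ)) ^ 2 +
      (β + M) / (2 * β) * (B * (r * Real.sin φ)) ^ 2 = r ^ 2 := by
    field_simp
    linear_combination r ^ 2 * Real.cos φ ^ 2 * hA + r ^ 2 * Real.sin φ ^ 2 * hB +
      2 * β * r ^ 2 * Real.sin_sq_add_cos_sq φ
  rw [h]
  ring

theorem hamiltonian_orbitPoint (hβ : β ≠ 0) (hA : A ^ 2 * (β - M) = 2 * β)
    (hB : B ^ 2 * (β + M) = 2 * β) (ε φ : ℝ) :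
    hamiltonian (orbitPoint β M A B ε φ) = M ^ 2 + ε ^ 2 := by
  rw [orbitPoint, hamiltonian_polar hβ hA hB, orbitRadius_energy]

theorem hasDerivAt_orbitPoint (hβ : β ≠ 0) (hA0 : A ≠ 0) (hB0 : B ≠ 0)
    (hA : A ^ 2 * (β - M) = 2 * β) (hB : B ^ 2 * (β + M) = 2 * β) (hε : 0 < ε) {θ : ℝ → ℝ}
    (hθ : ∀ t, HasDerivAt θ (-2 * (β / (A * B)) * angularSpeed β A B ε (θ t)) t) (t : ℝ) :
    HasDerivAt (fun t => orbitPoint β M A B ε (θ t))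
      (vectorField β (orbitPoint β M A B ε (θ t))) t := by
  have hg : angularSpeed β A B ε (θ t) ≠ 0 := angularSpeed_pos.ne'
  have hr := (hasDerivAt_orbitRadius (β := β) (A := A) (B := B) hε (θ t)).comp t (hθ t)
  have hge := angularSpeed_eq (β := β) (A := A) (B := B) (ε := ε) (φ := θ t)
  have hz : ∀ r : ℝ, ((B * (r * Real.sin (θ t))) ^ 2 - (A * (r * Real.cos (θ t))) ^ 2) / (4 * β) =
      heightShape β A B (θ t) * r ^ 2 := fun r => by rw [heightShape]; ring
  have hkA : 2 * A * (β / (A * B)) = B * (β + M) := by field_simp; linarith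
  have hkB : 2 * B * (β / (A * B)) = A * (β - M) := by field_simp; linarith
  -- This identity and the next evaluate q' cos + 2q sin and q' sin - 2q cos; they supply the cubic
  -- terms of x' and y'.
  have hsin : B * (β + M) * (Real.sin (θ t) * Real.cos (θ t) * (A ^ 2 + B ^ 2) / (2 * β) *
      Real.cos (θ t) + 2 * heightShape β A B (θ t) * Real.sin (θ t)) = B * Real.sin (θ t) := by
    rw [heightShape]
    field_simp
    linear_combination (4 * Real.sin (θ t)) * hB + (4 * B ^ 2 * (β + M) * Real.sin (θ t)) *
      Real.sin_sq_add_cos_sq (θ t)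
  have hcos : A * (β - M) * (Real.sin (θ t) * Real.cos (θ t) * (A ^ 2 + B ^ 2) / (2 * β) *
      Real.sin (θ t) - 2 * heightShape β A B (θ t) * Real.cos (θ t)) = A * Real.cos (θ t) := by
    rw [heightShape]
    field_simp
    linear_combination (4 * Real.cos (θ t)) * hA + (4 * A ^ 2 * (β - M) * Real.cos (θ t)) *
      Real.sin_sq_add_cos_sq (θ t)
  refine hasDerivAt_graphPoint hβ
    (x := fun t => A * (orbitRadius β A B ε (θ t) * Real.cos (θ t)))
    (y := fun t => B * (orbitRadius β A B ε (θ t) * Real.sin (θ t)))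
    (((hr.mul (hθ t).cos).const_mul A).congr_deriv ?_)
    (((hr.mul (hθ t).sin).const_mul B).congr_deriv ?_)
  -- In r' = (dr/dφ)·θ' the angular speed cancels. With g = 1 + 2q²r² in the rotational term, the
  -- rest is polynomial.
  all_goals
    simp only [Function.comp_apply]
    rw [hz]
    generalize heightShape β A B (θ t) = q at *
    generalize orbitRadius β A B ε (θ t) = r at *
    generalize Real.sin (θ t) * Real.cos (θ t) * (A ^ 2 + B ^ 2) / (2 * β) = Q at *
    generalize angularSpeed β A B ε (θ t) = g at *
    generalize Real.sin (θ t) = s at *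
    generalize Real.cos (θ t) = c at *
    generalize β / (A * B) = k at *
    rw [div_mul_eq_mul_div, show -(q * Q * r ^ 3) * (-2 * k * g) = 2 * k * q * Q * r ^ 3 * g by ring,
      mul_div_cancel_right₀ _ hg]
  · linear_combination (r * s + r ^ 3 * q * (Q * c + 2 * q * s)) * hkA + r ^ 3 * q * hsin +
      2 * A * k * r * s * hge
  · linear_combination (-(r * c) + r ^ 3 * q * (Q * s - 2 * q * c)) * hkB + r ^ 3 * q * hcos -
      2 * B * k * r * c * hge

end Polar

/-! ### The family of periodic orbits -/

section Periodic

variable {β M A B : ℝ} {F : ℝ → E3 → E3}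

/-- A point of the leaf is determined by its angle and its energy, in elliptic polar
coordinates. -/
theorem exists_orbitPoint_eq (hβ : β ≠ 0) (hA0 : 0 < A) (hB0 : 0 < B)
    (hA : A ^ 2 * (β - M) = 2 * β) (hB : B ^ 2 * (β + M) = 2 * β) {ε : ℝ} (hε : 0 < ε) {q : E3}
    (hq : q ∈ leaf β (-β * M)) (hH : hamiltonian q = M ^ 2 + ε ^ 2) :
    ∃ φ, orbitPoint β M A B ε φ = q := by
  set w : ℂ := ⟨q 0 / A, q 1 / B⟩ with hw
  have h0 : A * (‖w‖ * Real.cos w.arg) = q 0 := by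
    rw [Complex.norm_mul_cos_arg]
    exact mul_div_cancel₀ _ hA0.ne'
  have h1 : B * (‖w‖ * Real.sin w.arg) = q 1 := by
    rw [Complex.norm_mul_sin_arg]
    exact mul_div_cancel₀ _ hB0.ne'
  have hqe : q = graphPoint β M (A * (‖w‖ * Real.cos w.arg)) (B * (‖w‖ * Real.sin w.arg)) := by
    rw [h0, h1]
    exact eq_graphPoint_of_mem_leaf hβ hq
  have he : ‖w‖ ^ 2 + heightShape β A B w.arg ^ 2 * ‖w‖ ^ 4 = ε ^ 2 := by
    rw [hqe, hamiltonian_polar hβ hA hB] at hH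
    linarith
  have hr := orbitRadius_energy (β := β) (A := A) (B := B) (ε := ε) (φ := w.arg)
  have hpos := orbitRadius_pos (β := β) (A := A) (B := B) (φ := w.arg) hε
  have heq : ‖w‖ = orbitRadius β A B ε w.arg := by
    set r := orbitRadius β A B ε w.arg
    set ρ := ‖w‖
    set s := heightShape β A B w.arg
    have hρ : 0 ≤ ρ := norm_nonneg w
    -- On a ray the energy ρ² + s²ρ⁴ is injective in ρ ≥ 0, as the second factor is positive.
    have h : (ρ - r) * ((ρ + r) * (1 + s ^ 2 * (ρ ^ 2 + r ^ 2))) = 0 := by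
      linear_combination he - hr
    rcases mul_eq_zero.1 h with h | h
    · linarith
    · have : 0 < (ρ + r) * (1 + s ^ 2 * (ρ ^ 2 + r ^ 2)) := by positivity
      exact absurd h this.ne'
  exact ⟨w.arg, by rw [orbitPoint, ← heq, ← hqe]⟩

/-- The time of a full revolution on the orbit of energy `M² + ε²`. -/
noncomputable def orbitPeriod (β A B ε : ℝ) : ℝ :=
  (∫ φ in (0 : ℝ)..2 * Real.pi, (angularSpeed β A B ε φ)⁻¹) / (2 * |β / (A * B)|)

theorem continuous_orbitPeriod : Continuous (orbitPeriod β A B) := by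
  refine Continuous.div_const ?_ _
  refine intervalIntegral.continuous_parametric_intervalIntegral_of_continuous'
    (f := fun ε φ => (angularSpeed β A B ε φ)⁻¹) ?_ _ _
  exact continuous_angularSpeed.inv₀ fun _ => angularSpeed_pos.ne'

theorem orbitPeriod_zero : orbitPeriod β A B 0 = Real.pi / |β / (A * B)| := by
  have h : ∀ φ, angularSpeed β A B 0 φ = 1 := fun φ => by simp [angularSpeed]
  simp only [orbitPeriod, h]
  simp
  rw [mul_div_mul_left _ _ two_ne_zero]

theorem IsFlowOn.orbit_orbitPoint (hβ : β ≠ 0) (hA0 : 0 < A) (hB0 : 0 < B)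
    (hA : A ^ 2 * (β - M) = 2 * β) (hB : B ^ 2 * (β + M) = 2 * β)
    (hF : IsFlowOn (vectorField β) (leaf β (-β * M)) F) {ε : ℝ} (hε : 0 < ε) :
    orbit F (orbitPoint β M A B ε 0) =
        {q | q ∈ leaf β (-β * M) ∧ hamiltonian q = M ^ 2 + ε ^ 2} ∧
      HasMinimalPeriod F (orbitPoint β M A B ε 0) (orbitPeriod β A B ε) := by
  obtain ⟨e, he, hed, hep⟩ := exists_orderIso_integral_inv
    (continuous_angularSpeed.comp (f := fun φ : ℝ => (ε, φ)) (by fun_prop))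
    (fun φ => angularSpeed_pos (β := β) (A := A) (B := B) (ε := ε) (φ := φ))
    angularSpeed_periodic Real.two_pi_pos
  simp only [Function.comp_apply] at he hed
  set k := β / (A * B) with hk
  have hk0 : k ≠ 0 := div_ne_zero hβ (mul_pos hA0 hB0).ne'
  have hkabs : 0 < |k| := abs_pos.2 hk0
  have he0 : e 0 = 0 := by rw [he, intervalIntegral.integral_same]
  have hes0 : e.symm 0 = 0 := by rw [e.symm_apply_eq, he0]
  set P := e (2 * Real.pi) with hP
  have hP0 : 0 < P := by rw [← he0]; exact e.strictMono Real.two_pi_pos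
  have hT : orbitPeriod β A B ε = P / (2 * |k|) := by rw [orbitPeriod, hP, he]
  have hmem : orbitPoint β M A B ε 0 ∈ leaf β (-β * M) := orbitPoint_mem_leaf hβ
  have hflow : ∀ t, F t (orbitPoint β M A B ε 0) = orbitPoint β M A B ε (e.symm (-2 * k * t)) := by
    intro t
    have hθ : ∀ t, HasDerivAt (fun t => e.symm (-2 * k * t))
        (-2 * (β / (A * B)) * angularSpeed β A B ε (e.symm (-2 * k * t))) t := fun t => by
      have := (hed (-2 * k * t)).comp t ((hasDerivAt_id t).const_mul (-2 * k))
      refine this.congr_deriv ?_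
      rw [hk]
      ring
    have h0 : orbitPoint β M A B ε (e.symm (-2 * k * 0)) = orbitPoint β M A B ε 0 := by
      rw [mul_zero, hes0]
    have := hF.eq_integralCurve (hasDerivAt_orbitPoint (M := M) hβ hA0.ne' hB0.ne' hA hB hε hθ)
      (h0 ▸ hmem) t
    rwa [h0] at this
  have hperiodic : Function.Periodic (fun s => orbitPoint β M A B ε (e.symm s)) P := by
    intro s
    have : e.symm (s + P) = e.symm s + 2 * Real.pi := by
      rw [e.symm_apply_eq, hep, e.apply_symm_apply]
    simp only [this, orbitPoint_periodic (e.symm s)]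
  refine ⟨Subset.antisymm ?_ ?_, ?_, ?_, ?_⟩
  · rintro _ ⟨t, rfl⟩
    exact ⟨hF.mapsTo t hmem, by
      rw [hF.hamiltonian_eq hmem, hamiltonian_orbitPoint hβ hA hB]⟩
  · rintro q ⟨hq, hH⟩
    obtain ⟨φ, rfl⟩ := exists_orbitPoint_eq hβ hA0 hB0 hA hB hε hq hH
    refine ⟨e φ / (-2 * k), ?_⟩
    simp only [hflow]
    rw [mul_div_cancel₀ _ (by simpa using hk0), e.symm_apply_apply]
  · rw [hT]
    positivity
  · intro t
    rw [hflow, hflow, hT]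
    -- The sign of `k` is the sense of rotation: one period shifts the rescaled time by `-P` or by
    -- `P`.
    rcases abs_cases k with ⟨h, -⟩ | ⟨h, -⟩
    · have : -2 * k * (t + P / (2 * |k|)) = -2 * k * t - P := by
        rw [h]; field_simp; ring
      rw [this]
      exact hperiodic.sub_eq _
    · have : -2 * k * (t + P / (2 * |k|)) = -2 * k * t + P := by
        rw [h]; field_simp; ring
      rw [this]
      exact hperiodic _
  · intro s hs hsT heq
    rw [hflow] at heq
    set φ := e.symm (-2 * k * s) with hφ
    -- Less than a full turn has been made in either direction. A return forces sin φ = 0 and cos φ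
    -- > 0, so φ = 0 and `s = 0`.
    have hs' : |-2 * k * s| < P := by
      rw [hT, lt_div_iff₀ (by positivity)] at hsT
      rw [abs_mul, abs_mul, abs_of_pos hs, abs_neg, abs_two]
      linarith
    have hneg : e (-(2 * Real.pi)) = -P := by
      have := hep (-(2 * Real.pi))
      rw [neg_add_cancel, he0] at this
      linarith
    have hφ1 : φ < 2 * Real.pi := by
      rw [hφ, e.symm_apply_lt]
      exact (abs_lt.1 hs').2
    have hφ2 : -(2 * Real.pi) < φ := by
      rw [hφ, e.lt_symm_apply, hneg]
      exact (abs_lt.1 hs').1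
    have hr := orbitRadius_pos (β := β) (A := A) (B := B) (φ := φ) hε
    have hr0 := orbitRadius_pos (β := β) (A := A) (B := B) (φ := 0) hε
    have c0 := congrArg (fun p : E3 => p 0) heq
    have c1 := congrArg (fun p : E3 => p 1) heq
    simp [orbitPoint, graphPoint, hA0.ne'] at c0
    simp [orbitPoint, graphPoint, hB0.ne', hr.ne'] at c1
    have hcos : Real.cos φ = 1 := by
      have h1 := Real.sin_sq_add_cos_sq φ
      rw [c1] at h1
      have h2 : 0 < Real.cos φ := by
        by_contra! h
        nlinarith
      nlinarith
    rw [Real.cos_eq_one_iff_of_lt_of_lt hφ2 hφ1, hφ, e.symm_apply_eq, he0] at hcos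
    exact mul_ne_zero hk0 hs.ne' (by linarith)

/-- Under scaling of (x, y) by s in [0, 1], the nonnegative terms of H - M² acquire factors s² and
s⁴, so the sublevel set projects to a star-shaped set. -/
theorem isPreconnected_hamiltonian_lt (h : |M| < |β|) {c : ℝ} (hc : 0 < c) :
    IsPreconnected {q | q ∈ leaf β (-β * M) ∧ hamiltonian q < M ^ 2 + c} := by
  have hβ : β ≠ 0 := abs_pos.1 ((abs_nonneg M).trans_lt h)
  have ha := sub_div_pos_of_abs_lt h
  have hb := add_div_pos_of_abs_lt h
  set D : Set (ℝ × ℝ) := {v | hamiltonian (graphPoint β M v.1 v.2) < M ^ 2 + c} with hD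
  have hstar : StarConvex ℝ 0 D := by
    rw [starConvex_zero_iff]
    intro v hv s hs0 hs1
    simp only [hD, mem_ofPred_eq, hamiltonian_graphPoint hβ, Prod.smul_fst, Prod.smul_snd,
      smul_eq_mul] at hv ⊢
    set a := (β - M) / (2 * β)
    set b := (β + M) / (2 * β)
    have e : ((s * v.2) ^ 2 - (s * v.1) ^ 2) / (4 * β) =
      s ^ 2 * ((v.2 ^ 2 - v.1 ^ 2) / (4 * β)) := by ring
    rw [e, mul_pow, mul_pow, mul_pow]
    have hs : s ^ 2 ≤ 1 := pow_le_one₀ hs0 hs1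
    have hs2 : (s ^ 2) ^ 2 ≤ 1 := pow_le_one₀ (sq_nonneg s) hs
    have h1 := mul_le_of_le_one_left (mul_nonneg ha.le (sq_nonneg v.1)) hs
    have h2 := mul_le_of_le_one_left (mul_nonneg hb.le (sq_nonneg v.2)) hs
    have h3 := mul_le_of_le_one_left (sq_nonneg ((v.2 ^ 2 - v.1 ^ 2) / (4 * β))) hs2
    linarith
  have hne : (0 : ℝ × ℝ) ∈ D := by
    simp [hD, graphPoint_zero, hamiltonian_eqPoint, hc]
  have himg : {q | q ∈ leaf β (-β * M) ∧ hamiltonian q < M ^ 2 + c} =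
      (fun v : ℝ × ℝ => graphPoint β M v.1 v.2) '' D := by
    ext q
    constructor
    · rintro ⟨hq, hH⟩
      have hqe := eq_graphPoint_of_mem_leaf hβ hq
      exact ⟨(q 0, q 1), by rwa [hD, mem_ofPred_eq, ← hqe], hqe.symm⟩
    · rintro ⟨v, hv, rfl⟩
      exact ⟨graphPoint_mem_leaf hβ .., hv⟩
  rw [himg]
  exact (hstar.isPathConnected hne).isConnected.isPreconnected.image _
    (continuous_graphPoint β M).continuousOn

theorem connectedComponentIn_hamiltonian (h : |M| < |β|) {c : ℝ} (hc : 0 < c) :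
    connectedComponentIn (leaf β (-β * M) \
        {q | q ∈ leaf β (-β * M) ∧ hamiltonian q = M ^ 2 + c}) (eqPoint M) =
      {q | q ∈ leaf β (-β * M) ∧ hamiltonian q < M ^ 2 + c} := by
  set S := leaf β (-β * M) \ {q | q ∈ leaf β (-β * M) ∧ hamiltonian q = M ^ 2 + c} with hS
  have hp : eqPoint M ∈ S :=
    ⟨eqPoint_mem_leaf β M, fun hh => hc.ne' (by linarith [hh.2, hamiltonian_eqPoint M])⟩
  apply Subset.antisymm
  · intro q hq
    have hqS := connectedComponentIn_subset _ _ hq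
    refine ⟨hqS.1, ?_⟩
    by_contra! hge
    -- The energies attained on the component form an interval that contains M² and misses M² + c.
    have hpre := (isPreconnected_connectedComponentIn (F := S) (x := eqPoint M)).image hamiltonian
      differentiable_hamiltonian.continuous.continuousOn
    obtain ⟨r, hr, hrc⟩ := hpre.ordConnected.out
      (mem_image_of_mem _ (mem_connectedComponentIn hp)) (mem_image_of_mem _ hq)
      (show M ^ 2 + c ∈ Icc _ _ from ⟨by rw [hamiltonian_eqPoint]; linarith, hge⟩)
    have hrS := connectedComponentIn_subset _ _ hr
    exact hrS.2 ⟨hrS.1, hrc⟩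
  · refine (isPreconnected_hamiltonian_lt h hc).subset_connectedComponentIn ?_ ?_
    · exact ⟨eqPoint_mem_leaf β M, by rw [hamiltonian_eqPoint]; linarith⟩
    · exact fun q hq => ⟨hq.1, fun hh => hq.2.ne hh.2⟩

theorem eq_eqPoint_or_hamiltonian_gt (h : |M| < |β|) {q : E3} (hq : q ∈ leaf β (-β * M)) :
    q = eqPoint M ∨ M ^ 2 < hamiltonian q := by
  by_cases hgt : M ^ 2 < hamiltonian q
  · exact Or.inr hgt
  refine Or.inl (Set.mem_singleton_iff.1 ?_)
  by_contra hne
  -- Applied to the complement of `q`: if `q` had energy at most M², it would lie in its own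
  -- complement.
  obtain ⟨δ, hδ, hsub⟩ := exists_hamiltonian_lt_subset h
    (isOpen_compl_singleton.mem_nhds (x := eqPoint M) (show eqPoint M ∈ ({q} : Set E3)ᶜ from
      fun hh => hne (Set.mem_singleton_iff.1 hh).symm))
  exact hsub q hq (by linarith) rfl

theorem IsFlowOn.exists_periodic_family (hF : IsFlowOn (vectorField β) (leaf β (-β * M)) F)
    (h : |M| < |β|) :
    ∃ ε₀ : ℝ, 0 < ε₀ ∧ ∃ (x : ℝ → E3) (T : ℝ → ℝ),
      ContinuousOn x (Ioc 0 ε₀) ∧ ContinuousOn T (Ioc 0 ε₀) ∧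
      (∀ ε ∈ Ioc 0 ε₀, x ε ∈ leaf β (-β * M) ∧ HasMinimalPeriod F (x ε) (T ε) ∧
        orbit F (x ε) ⊆ leaf β (-β * M)) ∧
      (Ioc 0 ε₀).PairwiseDisjoint (fun ε => orbit F (x ε)) ∧
      (∀ U ∈ 𝓝 (eqPoint M), ∀ᶠ ε in 𝓝[>] (0 : ℝ), orbit F (x ε) ⊆ U) ∧
      Tendsto T (𝓝[>] 0) (𝓝 (2 * Real.pi / Real.sqrt (β ^ 2 - M ^ 2))) ∧
      connectedComponentIn (leaf β (-β * M) \ orbit F (x ε₀)) (eqPoint M) =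
        {eqPoint M} ∪ ⋃ ε ∈ Ioo 0 ε₀, orbit F (x ε) := by
  have hβ : β ≠ 0 := abs_pos.1 ((abs_nonneg M).trans_lt h)
  have ha := sub_div_pos_of_abs_lt h
  have hb := add_div_pos_of_abs_lt h
  have hβM : β - M ≠ 0 := fun hh => by rw [hh, zero_div] at ha; exact ha.false
  have hβM' : β + M ≠ 0 := fun hh => by rw [hh, zero_div] at hb; exact hb.false
  -- `A` and `B` are the semiaxes for which the quadratic part of H - M² becomes r².
  obtain ⟨A, hA0, hA⟩ : ∃ A : ℝ, 0 < A ∧ A ^ 2 * (β - M) = 2 * β := by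
    refine ⟨√(((β - M) / (2 * β))⁻¹), Real.sqrt_pos.2 (inv_pos.2 ha), ?_⟩
    rw [Real.sq_sqrt (inv_pos.2 ha).le]
    field_simp
  obtain ⟨B, hB0, hB⟩ : ∃ B : ℝ, 0 < B ∧ B ^ 2 * (β + M) = 2 * β := by
    refine ⟨√(((β + M) / (2 * β))⁻¹), Real.sqrt_pos.2 (inv_pos.2 hb), ?_⟩
    rw [Real.sq_sqrt (inv_pos.2 hb).le]
    field_simp
  have horb := fun {ε : ℝ} (hε : 0 < ε) => hF.orbit_orbitPoint hβ hA0 hB0 hA hB hε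
  -- The family exists for every ε > 0, so the bound 1 is arbitrary.
  refine ⟨1, one_pos, fun ε => orbitPoint β M A B ε 0, orbitPeriod β A B,
    (continuous_orbitPoint 0).continuousOn, continuous_orbitPeriod.continuousOn, ?_, ?_, ?_, ?_, ?_⟩
  · intro ε hε
    refine ⟨orbitPoint_mem_leaf hβ, (horb hε.1).2, ?_⟩
    rw [(horb hε.1).1]
    exact fun q hq => hq.1
  · intro ε hε ε' hε' hne
    simp only [Function.onFun]
    rw [(horb hε.1).1, (horb hε'.1).1, Set.disjoint_left]
    intro q hq hq'
    refine hne ((sq_eq_sq₀ hε.1.le hε'.1.le).1 ?_)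
    linarith [hq.2, hq'.2]
  · intro U hU
    obtain ⟨δ, hδ, hsub⟩ := exists_hamiltonian_lt_subset h hU
    have hlim : ∀ᶠ ε in 𝓝[>] (0 : ℝ), ε ^ 2 < δ := by
      refine Eventually.filter_mono nhdsWithin_le_nhds ?_
      exact (continuous_pow 2).continuousAt.eventually_lt continuousAt_const (by simpa using hδ)
    filter_upwards [hlim, self_mem_nhdsWithin] with ε hε hε0
    rw [(horb hε0).1]
    exact fun q hq => hsub q hq.1 (by linarith [hq.2])
  -- The frequency: 4β²/(A²B²) = (β - M)(β + M).
  · have hk : Real.sqrt (β ^ 2 - M ^ 2) = 2 * |β / (A * B)| := by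
      rw [← Real.sqrt_sq (by positivity : 0 ≤ 2 * |β / (A * B)|), mul_pow, sq_abs, div_pow]
      congr 1
      field_simp
      apply mul_left_cancel₀ hβ
      linear_combination (B ^ 2 * (β + M) * β) * hA + 2 * β ^ 2 * hB
    rw [hk, mul_div_mul_left _ _ two_ne_zero, ← orbitPeriod_zero]
    exact continuous_orbitPeriod.continuousAt.tendsto.mono_left nhdsWithin_le_nhds
  · rw [(horb one_pos).1, connectedComponentIn_hamiltonian h (by norm_num)]
    ext q
    simp only [mem_union, mem_singleton_iff, mem_iUnion, exists_prop]
    constructor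
    · rintro ⟨hq, hlt⟩
      refine (eq_eqPoint_or_hamiltonian_gt h hq).imp id fun hgt => ?_
      have hpos : 0 < hamiltonian q - M ^ 2 := by linarith
      refine ⟨√(hamiltonian q - M ^ 2), ⟨Real.sqrt_pos.2 hpos, ?_⟩, ?_⟩
      · rw [Real.sqrt_lt' one_pos]
        linarith
      · rw [(horb (Real.sqrt_pos.2 hpos)).1]
        exact ⟨hq, by rw [Real.sq_sqrt hpos.le]; ring⟩
    · rintro (rfl | ⟨ε, hε, hq⟩)
      · exact ⟨eqPoint_mem_leaf β M, by rw [hamiltonian_eqPoint]; linarith⟩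
      · rw [(horb hε.1).1] at hq
        refine ⟨hq.1, ?_⟩
        have := pow_lt_pow_left₀ hε.2 hε.1.le two_ne_zero
        linarith [hq.2]

end Periodic

end Rikitake

theorem theorem7p3 (β : ℝ) (hβ : β ≠ 0) (M : ℝ) :
    -- `(0, 0, M)` is an equilibrium on the paraboloid
    Rikitake.vectorField β (Rikitake.eqPoint M) = 0 ∧
    Rikitake.eqPoint M ∈ Rikitake.leaf β (-β * M) ∧
    -- the Hamiltonian realization, and the paraboloid as its regular symplectic leaf
    Rikitake.vectorField β =
      Rikitake.hamiltonianVectorField (fun _ => -1) (Rikitake.casimir β) Rikitake.hamiltonian ∧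
    Rikitake.symplecticLeaf (fun _ => -1) (Rikitake.casimir β) (Rikitake.eqPoint M) =
      Rikitake.leaf β (-β * M) ∧
    (∀ p ∈ Rikitake.leaf β (-β * M),
      (Rikitake.poissonMatrix (fun _ => -1) (Rikitake.casimir β) p).rank = 2) ∧
    -- the restricted vector field is complete, and its flow has the following properties
    (∃ F, Rikitake.IsFlowOn (Rikitake.vectorField β) (Rikitake.leaf β (-β * M)) F) ∧
    ∀ F, Rikitake.IsFlowOn (Rikitake.vectorField β) (Rikitake.leaf β (-β * M)) F →
      -- (a)
      ((∃! L, Rikitake.IsLinearizationOn F (Rikitake.leaf β (-β * M)) (Rikitake.casimir β)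
          (Rikitake.eqPoint M) L) ∧
        ∀ L, Rikitake.IsLinearizationOn F (Rikitake.leaf β (-β * M)) (Rikitake.casimir β)
            (Rikitake.eqPoint M) L →
          L.charpoly = Polynomial.X ^ 2 + Polynomial.C (β ^ 2 - M ^ 2)) ∧
      -- (b)
      (|β| < |M| →
        ¬ Rikitake.LyapunovStableOn F (Rikitake.leaf β (-β * M)) (Rikitake.eqPoint M)) ∧
      -- (c)
      (|M| < |β| →
        Rikitake.LyapunovStableOn F (Rikitake.leaf β (-β * M)) (Rikitake.eqPoint M)) ∧
      -- (d)
      (|M| < |β| →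
        ∃ ε₀ : ℝ, 0 < ε₀ ∧ ∃ (x : ℝ → Rikitake.E3) (T : ℝ → ℝ),
          -- a continuous one-parameter family of pairwise disjoint periodic orbits in the leaf
          ContinuousOn x (Ioc 0 ε₀) ∧ ContinuousOn T (Ioc 0 ε₀) ∧
          (∀ ε ∈ Ioc 0 ε₀, x ε ∈ Rikitake.leaf β (-β * M) ∧
            Rikitake.HasMinimalPeriod F (x ε) (T ε) ∧
            Rikitake.orbit F (x ε) ⊆ Rikitake.leaf β (-β * M)) ∧
          (Ioc 0 ε₀).PairwiseDisjoint (fun ε => Rikitake.orbit F (x ε)) ∧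
          -- the orbits shrink to the equilibrium
          (∀ U ∈ 𝓝 (Rikitake.eqPoint M), ∀ᶠ ε in 𝓝[>] (0 : ℝ), Rikitake.orbit F (x ε) ⊆ U) ∧
          -- limit of the periods
          Tendsto T (𝓝[>] 0) (𝓝 (2 * Real.pi / Real.sqrt (β ^ 2 - M ^ 2))) ∧
          -- the region that the outermost orbit encloses in the leaf
          connectedComponentIn (Rikitake.leaf β (-β * M) \ Rikitake.orbit F (x ε₀))
              (Rikitake.eqPoint M) =
            {Rikitake.eqPoint M} ∪ ⋃ ε ∈ Ioo 0 ε₀, Rikitake.orbit F (x ε)) := by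
  refine ⟨Rikitake.vectorField_eqPoint β M, Rikitake.eqPoint_mem_leaf β M,
    Rikitake.vectorField_eq_hamiltonianVectorField β, Rikitake.symplecticLeaf_eqPoint hβ M,
    fun p _ => Rikitake.rank_poissonMatrix hβ p, Rikitake.exists_isFlowOn_leaf β _, fun F hF => ?_⟩
  exact ⟨⟨hF.existsUnique_isLinearizationOn hβ, fun L hL => hF.charpoly_linearization hβ hL⟩,
    hF.not_lyapunovStableOn hβ, hF.lyapunovStableOn, hF.exists_periodic_family⟩
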